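/- Let $d\ge 2$, $0\le\alpha\le 1$, $\beta=(1-\alpha)/(d^2-1)$, and let $|\psi\rangle=\sum_{i=1}^d u_i|a_i\rangle|b_i\rangle\in\mathbb{C}^d\otimes\mathbb{C}^d$ be a unit vector in Schmidt form ($u_i\ge 0$; $\{a_i\}$, $\{b_i\}$ orthonormal bases of Alice's and Bob's spaces). Let $\rho=\alpha|\psi\rangle\langle\psi|+\beta(\mathbb{I}-|\psi\rangle\langle\psi|)$. Logarithms are to base 2, $0\log 0=0$, $S(\rho)=-\mathrm{tr}\,\rho\log\rho$ and $I(\rho)=S(\rho^A)+S(\rho^B)-S(\rho)$. For a POVM $\{E_k\}$ of Bob (finitely many outcomes) put $p_k=\mathrm{tr}[(\mathbb{I}\otimes E_k)\rho]$, $\rho^A_k=\mathrm{tr}_B[(\mathbb{I}\otimes E_k)\rho]/p_k$, $S(A|\{E_k\})=\sum_k p_kS(\rho^A_k)$ (outcomes with $p_k=0$ contribute $0$). A POVM is called optimal if it minimizes $S(A|\{E_k\})$ over all POVMs. The quantum discord is $D^{\leftarrow}(\rho)=I(\rho)-\sup_{\{E_k\}}\left[S(\rho^A)-S(A|\{E_k\})\right]$.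 Let $\mathcal{Q}c$ be the set of quantum-classical states $\sum_i p_i\rho_i\otimes|\eta_i\rangle\langle\eta_i|$ ($p$ a probability vector, $\rho_i$ density matrices, $\{\eta_i\}$ an orthonormal basis of Bob's space) and $\mathcal{F}c$ the set of fully classical states, i.e. those having such a form with pairwise commuting $\rho_i$. Let $S(\rho\|\sigma)=-S(\rho)-\mathrm{tr}\,\rho\log\sigma$ if $\ker\sigma\subseteq\ker\rho$ and $+\infty$ otherwise, and let $Q^{\leftarrow}(\rho)=\inf_{\sigma\in\mathcal{Q}c}S(\rho\|\sigma)$ and $Q(\rho)=\inf_{\sigma\in\mathcal{F}c}S(\rho\|\sigma)$ be the relative entropies of quantumness. Then: 1. $$D^{\leftarrow}(\rho)=\alpha\log\alpha+\tfrac{1-\alpha}{d+1}\log\tfrac{1-\alpha}{d^2-1}-\sum_{i=1}^d\tfrac{(1-\alpha)-u_i^2(1-d^2\alpha)}{d^2-1}\log\tfrac{(1-\alpha)-u_i^2(1-d^2\alpha)}{d^2-1}.$$ 2. The Schmidt basis $\{b_i\}$ is an eigenbasis of $\rho^B$, and the projective measurement in it is optimal. The projective measurement in any orthonormal eigenbasis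 of $\rho^B$ is optimal. Conversely, if $\alpha\neq 1$ and the projective measurement in an orthonormal basis $\{e_i\}$ is optimal, then $\{e_i\}$ is an eigenbasis of $\rho^B$. 3. $D^{\leftarrow}(\rho)=Q^{\leftarrow}(\rho)=Q(\rho)$. Both infima are attained at the state $\Delta(\rho)=\sum_{i,j}(|a_i\rangle\langle a_i|\otimes|b_j\rangle\langle b_j|)\,\rho\,(|a_i\rangle\langle a_i|\otimes|b_j\rangle\langle b_j|)$, which lies in $\mathcal{F}c\subseteq\mathcal{Q}c$. The measurement-induced disturbance in the Schmidt bases has the same value: $I(\rho)-I(\Delta(\rho))=D^{\leftarrow}(\rho)$. -/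

import Mathlib

open scoped ComplexOrder Kronecker Matrix

noncomputable section

namespace QuantumCorrelations

variable {m n ι : Type} [Fintype m] [Fintype n] [Fintype ι] [DecidableEq m] [DecidableEq n]

/-- The rank-one operator `|v⟩⟨v|`. -/
def ketBra (v : EuclideanSpace ℂ n) : Matrix n n ℂ :=
  Matrix.vecMulVec v.ofLp (star v.ofLp)

/-- A density matrix: positive semidefinite with trace one. -/
def IsDensity (ρ : Matrix n n ℂ) : Prop :=
  ρ.PosSemidef ∧ ρ.trace = 1

/-- The partial trace over the second (Bob's) factor. -/
def traceB (M : Matrix (m × n) (m × n) ℂ) : Matrix m m ℂ :=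
  Matrix.of fun x x' => ∑ y, M (x, y) (x', y)

/-- The partial trace over the first (Alice's) factor. -/
def traceA (M : Matrix (m × n) (m × n) ℂ) : Matrix n n ℂ :=
  Matrix.of fun y y' => ∑ x, M (x, y) (x, y')

/-- The base-2 logarithm of a Hermitian matrix, through the functional calculus.
Since `Real.logb 2 0 = 0`, it vanishes on the kernel of the matrix. -/
def matLog (M : Matrix n n ℂ) : Matrix n n ℂ :=
  cfc (Real.logb 2) M

/-- The von Neumann entropy `S(ρ) = -tr(ρ log ρ)` (in bits, with `0 log 0 = 0`). -/
def entropy (ρ : Matrix n n ℂ) : ℝ :=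
  -(ρ * matLog ρ).trace.re

/-- Quantum mutual information `I(ρ) = S(ρ^A) + S(ρ^B) - S(ρ)`. -/
def mutualInformation (ρ : Matrix (m × n) (m × n) ℂ) : ℝ :=
  entropy (traceB ρ) + entropy (traceA ρ) - entropy ρ

/-- A POVM with outcomes in the finite set `ι`. -/
def IsPOVM (E : ι → Matrix n n ℂ) : Prop :=
  (∀ i, (E i).PosSemidef) ∧ ∑ i, E i = 1

/-- The probability `tr((1 ⊗ F) ρ)` of the effect `F` measured on Bob's side. -/
def outcomeProb (ρ : Matrix (m × n) (m × n) ℂ) (F : Matrix n n ℂ) : ℝ :=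
  (((1 : Matrix m m ℂ) ⊗ₖ F) * ρ).trace.re

/-- Alice's normalized state `tr_B((1 ⊗ F) ρ) / p` after Bob has observed the effect `F`
(it is `0` when `F` has probability `p = 0`). -/
def postState (ρ : Matrix (m × n) (m × n) ℂ) (F : Matrix n n ℂ) : Matrix m m ℂ :=
  ((outcomeProb ρ F : ℂ))⁻¹ • traceB (((1 : Matrix m m ℂ) ⊗ₖ F) * ρ)

/-- The average conditional entropy `S(A|{E_i}) = ∑ p_i S(ρ^A_i)`. -/
def condEntropy (ρ : Matrix (m × n) (m × n) ℂ) (E : ι → Matrix n n ℂ) : ℝ :=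
  ∑ i, outcomeProb ρ (E i) * entropy (postState ρ (E i))

/-- The classical correlations: the supremum of `S(ρ^A) - S(A|{E_i})` over all POVMs of Bob
with finitely many outcomes. -/
def classicalCorrelations (ρ : Matrix (m × n) (m × n) ℂ) : ℝ :=
  sSup {x : ℝ | ∃ (k : ℕ) (E : Fin k → Matrix n n ℂ),
    IsPOVM E ∧ x = entropy (traceB ρ) - condEntropy ρ E}

/-- Quantum discord with respect to measurements on Bob's side. -/
def discord (ρ : Matrix (m × n) (m × n) ℂ) : ℝ :=
  mutualInformation ρ - classicalCorrelations ρ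

/-- `E` is a POVM on Bob's side which minimizes the average conditional entropy (equivalently,
maximizes `S(ρ^A) - S(A|{E_i})`) among all POVMs. -/
def IsOptimalMeasurement (ρ : Matrix (m × n) (m × n) ℂ) (E : ι → Matrix n n ℂ) : Prop :=
  IsPOVM E ∧ ∀ (k : ℕ) (F : Fin k → Matrix n n ℂ), IsPOVM F → condEntropy ρ E ≤ condEntropy ρ F

/-- The projective measurement in an orthonormal basis. -/
def basisMeasurement (e : OrthonormalBasis n ℂ (EuclideanSpace ℂ n)) : n → Matrix n n ℂ :=
  fun i => ketBra (e i)

/-- Every vector of the orthonormal basis `e` is an eigenvector of `M`. -/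
def IsEigenbasis (M : Matrix n n ℂ) (e : OrthonormalBasis n ℂ (EuclideanSpace ℂ n)) : Prop :=
  ∀ i, ∃ c : ℂ, M *ᵥ (e i).ofLp = c • (e i).ofLp

/-- Quantum-classical states `∑ p_i ρ_i ⊗ |η_i⟩⟨η_i|`. -/
def quantumClassical (m n : Type) [Fintype m] [Fintype n] [DecidableEq m] [DecidableEq n] :
    Set (Matrix (m × n) (m × n) ℂ) :=
  {σ | ∃ (p : n → ℝ) (τ : n → Matrix m m ℂ) (η : OrthonormalBasis n ℂ (EuclideanSpace ℂ n)),
    (∀ i, 0 ≤ p i) ∧ ∑ i, p i = 1 ∧ (∀ i, IsDensity (τ i)) ∧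
    σ = ∑ i, (p i : ℂ) • (τ i ⊗ₖ ketBra (η i))}

/-- Fully classical states: `∑ p_i ρ_i ⊗ |η_i⟩⟨η_i|` with pairwise commuting `ρ_i`. -/
def fullyClassical (m n : Type) [Fintype m] [Fintype n] [DecidableEq m] [DecidableEq n] :
    Set (Matrix (m × n) (m × n) ℂ) :=
  {σ | ∃ (p : n → ℝ) (τ : n → Matrix m m ℂ) (η : OrthonormalBasis n ℂ (EuclideanSpace ℂ n)),
    (∀ i, 0 ≤ p i) ∧ ∑ i, p i = 1 ∧ (∀ i, IsDensity (τ i)) ∧ (∀ i j, Commute (τ i) (τ j)) ∧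
    σ = ∑ i, (p i : ℂ) • (τ i ⊗ₖ ketBra (η i))}

open Classical in
/-- The quantum relative entropy `S(ρ‖σ) = -S(ρ) - tr(ρ log σ)`, with value `+∞` unless
the kernel of `σ` is contained in the kernel of `ρ`. -/
def relEntropy (ρ σ : Matrix n n ℂ) : EReal :=
  if ∀ v : n → ℂ, σ *ᵥ v = 0 → ρ *ᵥ v = 0 then
    ((-entropy ρ - (ρ * matLog σ).trace.re : ℝ) : EReal)
  else ⊤

/-- The one-sided relative entropy of quantumness. -/
def oneSidedREQ (ρ : Matrix (m × n) (m × n) ℂ) : EReal :=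
  sInf (relEntropy ρ '' quantumClassical m n)

/-- The (two-sided) relative entropy of quantumness. -/
def fullREQ (ρ : Matrix (m × n) (m × n) ℂ) : EReal :=
  sInf (relEntropy ρ '' fullyClassical m n)

/-- Dephasing by local projective measurements in the bases `a` (Alice) and `b` (Bob). -/
def dephase (a : OrthonormalBasis m ℂ (EuclideanSpace ℂ m))
    (b : OrthonormalBasis n ℂ (EuclideanSpace ℂ n)) (ρ : Matrix (m × n) (m × n) ℂ) :
    Matrix (m × n) (m × n) ℂ :=
  ∑ i, ∑ j, (ketBra (a i) ⊗ₖ ketBra (b j)) * ρ * (ketBra (a i) ⊗ₖ ketBra (b j))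

/-- `ψ = ∑ u_i |a_i⟩|b_i⟩` is a Schmidt decomposition, with Schmidt coefficients `u_i ≥ 0`. -/
def IsSchmidtDecomposition (ψ : EuclideanSpace ℂ (n × n)) (u : n → ℝ)
    (a b : OrthonormalBasis n ℂ (EuclideanSpace ℂ n)) : Prop :=
  (∀ i, 0 ≤ u i) ∧ ∀ x y, ψ (x, y) = ∑ i, (u i : ℂ) * (a i x * b i y)

/-- The pseudo-pure state `α|ψ⟩⟨ψ| + β(1 - |ψ⟩⟨ψ|)`, `β = (1 - α)/(d² - 1)`. -/
def pseudoPure (d : ℕ) (α : ℝ) (ψ : EuclideanSpace ℂ (Fin d × Fin d)) :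
    Matrix (Fin d × Fin d) (Fin d × Fin d) ℂ :=
  (α : ℂ) • ketBra ψ + (((1 - α) / ((d : ℝ) ^ 2 - 1) : ℝ) : ℂ) • (1 - ketBra ψ)

end QuantumCorrelations

end

set_option linter.unusedSectionVars false

noncomputable section

namespace QuantumCorrelations

variable {m n ι : Type} [Fintype m] [Fintype n] [Fintype ι]

/-! ### Rank-one operators and orthonormal bases -/

/-! The state is a rank-one spike on a flat background, ρ = γ|ψ⟩⟨ψ| + β with γ = α - β. The sign of
γ is not fixed; only β ≥ 0 and γ + β ≥ 0 are needed. If Bob observes |v⟩⟨v| with v a unit vector,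
Alice holds γ|φ⟩⟨φ| + β with φ = ⟨v|ψ⟩, again a spike, so the contribution p S of this outcome
depends only on x = ‖φ‖²: it is `profile d γ β x`. In the Schmidt form, x = ∑ |⟨b_i|v⟩|² u_i² is an
average of the u_i².

The function `profile` is concave in x, because -y log y + (y + c) log (y + c) is concave in y for c
≥ 0 (`strictConcaveOn_negMulLogb_sub_shift` for c > 0). Jensen bounds the contribution of v below by
∑ |⟨b_i|v⟩|² profile(u_i²). An arbitrary effect is a positive combination of rank-one effects, and
superadditivity of the homogeneous entropy extends the bound to it
(`outcomeProb_mul_entropy_spiked_ge`). Since the effects of a POVM sum to 1, S(A|{E_k}) ≥ ∑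
profile(u_i²), with equality for local eigenbases. For β > 0 the concavity is strict, and equality
forces γ u_i² to be constant on the support of each measured vector, which is exactly the
eigenvector condition for ρ^B (`isEigenbasis_of_condEntropy_le`).

For the relative entropies, a quantum-classical σ has an eigenbasis of product vectors. Gibbs'
inequality bounds -tr ρ log σ below by the Shannon entropy of the diagonal of ρ in that basis, and
two uses of concavity bound the latter by its value in the Schmidt product basis
(`spikedDiscord_le_relEntropy`). The state Δ(ρ) attains the bound. In the discord the entropies of
ρ^A and ρ^B cancel, leaving S(Δ(ρ)) - S(ρ), which is the same number; as Δ preserves both marginals,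
it is also the measurement-induced disturbance. -/

theorem ketBra_mulVec (v w : EuclideanSpace ℂ n) :
    ketBra v *ᵥ w.ofLp = inner ℂ v w • v.ofLp := by
  rw [ketBra, Matrix.vecMulVec_mulVec, EuclideanSpace.inner_eq_star_dotProduct, dotProduct_comm]
  ext i
  simp [mul_comm]

/-- The matrix element `⟨v|M|v⟩`. -/
def expVal (M : Matrix n n ℂ) (v : EuclideanSpace ℂ n) : ℂ :=
  star v.ofLp ⬝ᵥ M *ᵥ v.ofLp

theorem trace_mul_ketBra (M : Matrix n n ℂ) (v : EuclideanSpace ℂ n) :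
    (M * ketBra v).trace = expVal M v := by
  rw [ketBra, Matrix.mul_vecMulVec, Matrix.trace_vecMulVec, expVal, dotProduct_comm]

theorem trace_ketBra (v : EuclideanSpace ℂ n) : (ketBra v).trace = (‖v‖ ^ 2 : ℝ) := by
  rw [ketBra, Matrix.trace_vecMulVec, ← EuclideanSpace.inner_eq_star_dotProduct,
    inner_self_eq_norm_sq_to_K]
  simp

theorem expVal_add (M N : Matrix n n ℂ) (v : EuclideanSpace ℂ n) :
    expVal (M + N) v = expVal M v + expVal N v := by
  simp [expVal, Matrix.add_mulVec, dotProduct_add]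

theorem expVal_smul (c : ℂ) (M : Matrix n n ℂ) (v : EuclideanSpace ℂ n) :
    expVal (c • M) v = c * expVal M v := by
  simp [expVal, Matrix.smul_mulVec, dotProduct_smul]

theorem expVal_sum {κ : Type*} (s : Finset κ) (M : κ → Matrix n n ℂ) (v : EuclideanSpace ℂ n) :
    expVal (∑ i ∈ s, M i) v = ∑ i ∈ s, expVal (M i) v := by
  simp [expVal, Matrix.sum_mulVec, dotProduct_sum]

theorem expVal_of_eigenvector {M : Matrix n n ℂ} {v : EuclideanSpace ℂ n} {c : ℂ}
    (h : M *ᵥ v.ofLp = c • v.ofLp) : expVal M v = c * (‖v‖ ^ 2 : ℝ) := by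
  rw [expVal, h, dotProduct_smul, dotProduct_comm, ← EuclideanSpace.inner_eq_star_dotProduct,
    inner_self_eq_norm_sq_to_K]
  simp

theorem expVal_one [DecidableEq n] (v : EuclideanSpace ℂ n) : expVal 1 v = (‖v‖ ^ 2 : ℝ) := by
  simpa using expVal_of_eigenvector (M := 1) (v := v) (c := 1) (by simp)

theorem expVal_ketBra (v w : EuclideanSpace ℂ n) :
    expVal (ketBra v) w = (‖inner ℂ v w‖ ^ 2 : ℝ) := by
  rw [expVal, ketBra_mulVec, dotProduct_smul, dotProduct_comm,
    ← EuclideanSpace.inner_eq_star_dotProduct, ← inner_conj_symm w v, smul_eq_mul,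
    RCLike.mul_conj]
  simp

theorem sum_ketBra [DecidableEq n] (e : OrthonormalBasis ι ℂ (EuclideanSpace ℂ n)) :
    ∑ i, ketBra (e i) = 1 := by
  ext x y
  have h := e.sum_inner_mul_inner (EuclideanSpace.single x 1) (EuclideanSpace.single y 1)
  simp only [EuclideanSpace.inner_single_left, EuclideanSpace.inner_single_right, map_one,
    one_mul] at h
  simp only [Matrix.sum_apply, ketBra, Matrix.vecMulVec_apply, Pi.star_apply, Matrix.one_apply]
  simpa [Pi.single_apply, eq_comm] using h

theorem eq_of_forall_mulVec_eq [DecidableEq n] (e : OrthonormalBasis ι ℂ (EuclideanSpace ℂ n))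
    {M N : Matrix n n ℂ} (h : ∀ i, M *ᵥ (e i).ofLp = N *ᵥ (e i).ofLp) : M = N := by
  rw [← mul_one M, ← mul_one N, ← sum_ketBra e, Finset.mul_sum, Finset.mul_sum]
  refine Finset.sum_congr rfl fun i _ => ?_
  rw [ketBra, Matrix.mul_vecMulVec, Matrix.mul_vecMulVec, h]

theorem sum_smul_ketBra_mulVec (e : OrthonormalBasis ι ℂ (EuclideanSpace ℂ n)) (c : ι → ℂ)
    (j : ι) : (∑ i, c i • ketBra (e i)) *ᵥ (e j).ofLp = c j • (e j).ofLp := by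
  classical
  rw [Matrix.sum_mulVec, Finset.sum_eq_single j]
  · rw [Matrix.smul_mulVec, ketBra_mulVec]
    simp
  · intro i _ hij
    rw [Matrix.smul_mulVec, ketBra_mulVec, e.inner_eq_ite, if_neg hij]
    simp
  · simp

theorem eq_sum_smul_ketBra [DecidableEq n] (e : OrthonormalBasis ι ℂ (EuclideanSpace ℂ n))
    {M : Matrix n n ℂ} {c : ι → ℂ} (h : ∀ i, M *ᵥ (e i).ofLp = c i • (e i).ofLp) :
    M = ∑ i, c i • ketBra (e i) :=
  eq_of_forall_mulVec_eq e fun i => by rw [h, sum_smul_ketBra_mulVec]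

theorem ketBra_isHermitian {κ : Type} (v : EuclideanSpace ℂ κ) : (ketBra v).IsHermitian := by
  rw [ketBra, Matrix.IsHermitian, Matrix.conjTranspose_vecMulVec, star_star]

theorem ketBra_posSemidef (v : EuclideanSpace ℂ n) : (ketBra v).PosSemidef :=
  Matrix.posSemidef_vecMulVec_self_star _

theorem isHermitian_sum_smul_ketBra {κ : Type} (e : ι → EuclideanSpace ℂ κ) (q : ι → ℝ) :
    (∑ i, (q i : ℂ) • ketBra (e i)).IsHermitian := by
  rw [Matrix.IsHermitian, Matrix.conjTranspose_sum]
  refine Finset.sum_congr rfl fun i _ => ?_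
  rw [Matrix.conjTranspose_smul, (ketBra_isHermitian _).eq]
  simp

theorem _root_.Matrix.IsHermitian.eq_sum_eigenvalues_smul_ketBra [DecidableEq n]
    {M : Matrix n n ℂ} (hM : M.IsHermitian) :
    M = ∑ i, (hM.eigenvalues i : ℂ) • ketBra (hM.eigenvectorBasis i) := by
  refine eq_sum_smul_ketBra _ fun i => ?_
  rw [hM.mulVec_eigenvectorBasis]
  ext x
  simp

/-- The spectrum is finite, so f agrees on it with an interpolating polynomial, for which the claim
is clear. Taking c as an extra node avoids proving that c lies in the spectrum, which may fail when
v = 0. -/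
theorem cfc_mulVec_of_eigenvector [DecidableEq n] {M : Matrix n n ℂ}
    (hM : M.IsHermitian) {v : n → ℂ} {c : ℝ} (h : M *ᵥ v = (c : ℂ) • v) (f : ℝ → ℝ) :
    cfc f M *ᵥ v = (f c : ℂ) • v := by
  classical
  obtain ⟨p, hp⟩ : ∃ p : Polynomial ℝ,
      ∀ x ∈ insert c (Matrix.finite_real_spectrum (A := M)).toFinset,
      p.eval x = f x :=
    ⟨Lagrange.interpolate (insert c (Matrix.finite_real_spectrum (A := M)).toFinset) id f,
      fun x hx => Lagrange.eval_interpolate_at_node (v := id) f (Set.injOn_id _) hx⟩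
  have hf : cfc f M = Polynomial.aeval M p := by
    rw [← cfc_polynomial p M hM.isSelfAdjoint]
    refine cfc_congr fun x hx => (hp x ?_).symm
    simp [hx]
  rw [hf, ← hp c (by simp)]
  clear hp hf
  induction p using Polynomial.induction_on' with
  | add p q hp hq => simp [Matrix.add_mulVec, hp, hq, add_smul]
  | monomial k r =>
    have hk : M ^ k *ᵥ v = ((c : ℂ) ^ k) • v := by
      induction k with
      | zero => simp
      | succ k ih => rw [pow_succ, ← Matrix.mulVec_mulVec, h, Matrix.mulVec_smul, ih, smul_smul,
          pow_succ, mul_comm]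
    rw [Polynomial.aeval_monomial, ← Matrix.mulVec_mulVec, hk, Algebra.algebraMap_eq_smul_one,
      Matrix.smul_mulVec, Matrix.one_mulVec, Polynomial.eval_monomial]
    ext x
    simp [mul_assoc]

theorem cfc_sum_smul_ketBra [DecidableEq n]
    (e : OrthonormalBasis ι ℂ (EuclideanSpace ℂ n)) (q : ι → ℝ)
    (f : ℝ → ℝ) :
    cfc f (∑ i, (q i : ℂ) • ketBra (e i)) = ∑ i, (f (q i) : ℂ) • ketBra (e i) :=
  eq_sum_smul_ketBra e fun i => cfc_mulVec_of_eigenvector (isHermitian_sum_smul_ketBra _ _)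
    (sum_smul_ketBra_mulVec e _ i) f

/-- The function `x ↦ -x log₂ x`. -/
def negMulLogb (x : ℝ) : ℝ := -(x * Real.logb 2 x)

theorem trace_mul_matLog [DecidableEq n] (ρ : Matrix n n ℂ)
    (e : OrthonormalBasis ι ℂ (EuclideanSpace ℂ n))
    (q : ι → ℝ) :
    (ρ * matLog (∑ i, (q i : ℂ) • ketBra (e i))).trace.re =
      ∑ i, (expVal ρ (e i)).re * Real.logb 2 (q i) := by
  rw [matLog, cfc_sum_smul_ketBra, Finset.mul_sum, Matrix.trace_sum, Complex.re_sum]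
  refine Finset.sum_congr rfl fun i _ => ?_
  rw [Matrix.mul_smul, Matrix.trace_smul, trace_mul_ketBra, smul_eq_mul, Complex.re_ofReal_mul,
    mul_comm]

theorem expVal_sum_smul_ketBra (e : OrthonormalBasis ι ℂ (EuclideanSpace ℂ n)) (q : ι → ℝ)
    (i : ι) : expVal (∑ i, (q i : ℂ) • ketBra (e i)) (e i) = q i := by
  rw [expVal_of_eigenvector (sum_smul_ketBra_mulVec e _ i)]
  simp

theorem entropy_sum_smul_ketBra [DecidableEq n]
    (e : OrthonormalBasis ι ℂ (EuclideanSpace ℂ n)) (q : ι → ℝ) :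
    entropy (∑ i, (q i : ℂ) • ketBra (e i)) = ∑ i, negMulLogb (q i) := by
  rw [entropy, trace_mul_matLog, ← Finset.sum_neg_distrib]
  refine Finset.sum_congr rfl fun i _ => ?_
  rw [expVal_sum_smul_ketBra, negMulLogb, Complex.ofReal_re]

theorem trace_sum_smul_ketBra (e : OrthonormalBasis ι ℂ (EuclideanSpace ℂ n)) (q : ι → ℝ) :
    (∑ i, (q i : ℂ) • ketBra (e i)).trace.re = ∑ i, q i := by
  rw [Matrix.trace_sum, Complex.re_sum]
  refine Finset.sum_congr rfl fun i _ => ?_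
  rw [Matrix.trace_smul, trace_ketBra, e.norm_eq_one]
  simp

/-- The case v = 0 has to be included: ⟨v|ψ⟩ vanishes when Bob's vector is orthogonal to the support
of the Schmidt form. -/
theorem exists_orthonormalBasis_eq_smul [Nonempty n] (v : EuclideanSpace ℂ n) :
    ∃ (e : OrthonormalBasis n ℂ (EuclideanSpace ℂ n)) (i : n), v = (‖v‖ : ℂ) • e i := by
  classical
  obtain ⟨i⟩ := ‹Nonempty n›
  by_cases hv : v = 0
  · exact ⟨EuclideanSpace.basisFun n ℂ, i, by simp [hv]⟩
  · obtain ⟨e, he⟩ := Orthonormal.exists_orthonormalBasis_extension_of_card_eq (𝕜 := ℂ)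
      (E := EuclideanSpace ℂ n) (ι := n) (by simp)
      (v := fun _ => ((‖v‖ : ℂ)⁻¹) • v) (s := {i}) (by
        rw [orthonormal_iff_ite]
        rintro ⟨x, rfl⟩ ⟨y, rfl⟩
        have h1 : ‖((‖v‖ : ℂ)⁻¹) • v‖ = 1 := by
          rw [norm_smul, norm_inv, Complex.norm_real, norm_norm,
            inv_mul_cancel₀ (norm_ne_zero_iff.2 hv)]
        simpa using inner_self_eq_one_of_norm_eq_one (𝕜 := ℂ) h1)
    refine ⟨e, i, ?_⟩
    rw [he i rfl, smul_smul, mul_inv_cancel₀ (by simpa using hv), one_smul]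

/-- The spectral decomposition of `γ|v⟩⟨v| + β`. -/
theorem smul_ketBra_add_smul_one [DecidableEq n] [Nonempty n] (v : EuclideanSpace ℂ n) (γ β : ℝ) :
    ∃ (e : OrthonormalBasis n ℂ (EuclideanSpace ℂ n)) (i : n),
      (γ : ℂ) • ketBra v + (β : ℂ) • 1 =
        ∑ j, ((if j = i then γ * ‖v‖ ^ 2 + β else β : ℝ) : ℂ) • ketBra (e j) := by
  obtain ⟨e, i, hv⟩ := exists_orthonormalBasis_eq_smul v
  refine ⟨e, i, eq_sum_smul_ketBra e fun j => ?_⟩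
  rw [Matrix.add_mulVec, Matrix.smul_mulVec, Matrix.smul_mulVec, ketBra_mulVec, Matrix.one_mulVec]
  have h : inner ℂ v (e j) • v.ofLp = ((if j = i then ‖v‖ ^ 2 else 0 : ℝ) : ℂ) • (e j).ofLp := by
    conv_lhs => rw [hv]
    rw [inner_smul_left, e.inner_eq_ite]
    by_cases hij : j = i
    · subst hij
      ext x
      simp
      ring
    · simp [hij, Ne.symm hij]
  rw [h, smul_smul, ← add_smul]
  congr 1
  split_ifs <;> simp

/-! ### Scalar entropy inequalities -/

theorem negMulLogb_eq (x : ℝ) : negMulLogb x = Real.negMulLog x / Real.log 2 := by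
  simp only [negMulLogb, Real.negMulLog, Real.logb]
  ring

theorem negMulLogb_one : negMulLogb 1 = 0 := by simp [negMulLogb]

theorem negMulLogb_mul (x y : ℝ) :
    negMulLogb (x * y) = y * negMulLogb x + x * negMulLogb y := by
  simp only [negMulLogb_eq, Real.negMulLog_mul]
  ring

theorem concaveOn_negMulLogb : ConcaveOn ℝ (Set.Ici 0) negMulLogb := by
  have h := Real.concaveOn_negMulLog.smul (c := (Real.log 2)⁻¹)
    (inv_nonneg.2 (Real.log_nonneg one_le_two))
  refine h.congr fun x _ => ?_
  simp only [negMulLogb_eq, smul_eq_mul]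
  ring

/-- The derivative is log₂(1 + c/x), strictly decreasing for x > 0. This is the source of both the
optimality and the uniqueness of local eigenbases. -/
theorem strictConcaveOn_negMulLogb_sub_shift {c : ℝ} (hc : 0 < c) :
    StrictConcaveOn ℝ (Set.Ici 0) fun x => negMulLogb x - negMulLogb (x + c) := by
  have hlog : 0 < Real.log 2 := Real.log_pos one_lt_two
  have hd : ∀ x ∈ Set.Ioi (0 : ℝ), deriv (fun x => negMulLogb x - negMulLogb (x + c)) x =
      Real.log (1 + c / x) / Real.log 2 := by
    intro x hx
    have hx : 0 < x := hx
    have h1 : HasDerivAt negMulLogb ((-Real.log x - 1) / Real.log 2) x :=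
      ((Real.hasDerivAt_negMulLog hx.ne').div_const _).congr_of_eventuallyEq
        (Filter.Eventually.of_forall negMulLogb_eq)
    have h2 : HasDerivAt negMulLogb ((-Real.log (x + c) - 1) / Real.log 2) (x + c) :=
      ((Real.hasDerivAt_negMulLog (by positivity)).div_const _).congr_of_eventuallyEq
        (Filter.Eventually.of_forall negMulLogb_eq)
    rw [(h1.fun_sub (h2.comp_add_const x c)).deriv, show 1 + c / x = (x + c) / x by field_simp,
      Real.log_div (by positivity) hx.ne']
    ring
  refine StrictAntiOn.strictConcaveOn_of_deriv (convex_Ici 0) ?_ ?_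
  · have : Continuous negMulLogb := by
      simp only [funext negMulLogb_eq]
      fun_prop
    fun_prop
  · rw [interior_Ici]
    intro x hx y hy hxy
    rw [hd x hx, hd y hy]
    have hx : 0 < x := hx
    have hy : 0 < y := hy
    gcongr

theorem concaveOn_negMulLogb_sub_shift {c : ℝ} (hc : 0 ≤ c) :
    ConcaveOn ℝ (Set.Ici 0) fun x => negMulLogb x - negMulLogb (x + c) := by
  rcases hc.eq_or_lt with rfl | hc
  · simpa using concaveOn_const (0 : ℝ) (convex_Ici (0 : ℝ))
  · exact (strictConcaveOn_negMulLogb_sub_shift hc).concaveOn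

/-- The Shannon entropy of a nonnegative vector, extended homogeneously of degree one. -/
def homEntropy (A : ι → ℝ) : ℝ := ∑ j, negMulLogb (A j) - negMulLogb (∑ j, A j)

/-- Gibbs' inequality. -/
theorem homEntropy_le {b q : ι → ℝ} (hb : ∀ j, 0 ≤ b j) (hq : ∀ j, 0 ≤ q j) (hq1 : ∑ j, q j = 1)
    (h0 : ∀ j, q j = 0 → b j = 0) : homEntropy b ≤ -∑ j, b j * Real.logb 2 (q j) := by
  have hlog : 0 < Real.log 2 := Real.log_pos one_lt_two
  set B := ∑ j, b j with hB
  -- This is log t ≤ t - 1 at t = B q_j / b_j, multiplied by b_j. The terms with b_j = 0 are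
  -- separate, since there q_j may vanish too.
  have key : ∀ j, b j * (Real.log B + Real.log (q j) - Real.log (b j)) ≤ B * q j - b j := by
    intro j
    rcases (hb j).eq_or_lt with h | h
    · rw [← h]
      have : 0 ≤ B := Finset.sum_nonneg fun j _ => hb j
      simpa using mul_nonneg this (hq j)
    · have hBpos : 0 < B := h.trans_le (Finset.single_le_sum (fun j _ => hb j) (Finset.mem_univ j))
      have hqpos : 0 < q j := (hq j).lt_of_ne fun hj => h.ne' (h0 j hj.symm)
      have := Real.log_le_sub_one_of_pos (x := B * q j / b j) (by positivity)
      rw [Real.log_div (by positivity) h.ne', Real.log_mul hBpos.ne' hqpos.ne'] at this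
      calc _ ≤ b j * (B * q j / b j - 1) := by gcongr
        _ = _ := by field_simp
  have hsum := Finset.sum_le_sum fun j (_ : j ∈ Finset.univ) => key j
  rw [Finset.sum_sub_distrib, ← Finset.mul_sum, hq1, mul_one, ← hB, sub_self] at hsum
  have e : homEntropy b + ∑ j, b j * Real.logb 2 (q j) =
      (∑ j, b j * (Real.log B + Real.log (q j) - Real.log (b j))) / Real.log 2 := by
    have h1 : ∀ j, b j * (Real.log B + Real.log (q j) - Real.log (b j)) =
        b j * Real.log B + b j * Real.log (q j) - b j * Real.log (b j) := fun j => by ring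
    simp only [h1, Finset.sum_sub_distrib, Finset.sum_add_distrib, ← Finset.sum_mul, ← hB,
      homEntropy, negMulLogb, Real.logb, Finset.sum_neg_distrib, mul_div_assoc', ← Finset.sum_div]
    ring
  have := div_nonpos_of_nonpos_of_nonneg hsum hlog.le
  linarith

theorem homEntropy_smul (c : ℝ) (A : ι → ℝ) :
    homEntropy (fun j => c * A j) = c * homEntropy A := by
  simp only [homEntropy, ← Finset.mul_sum, negMulLogb_mul, Finset.sum_add_distrib,
    ← Finset.sum_mul]
  ring

/-- The equality case of Gibbs' inequality: the reference distribution is A itself, normalized. If A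
sums to zero, both sides vanish because division by zero gives zero. -/
theorem homEntropy_eq_neg_sum (A : ι → ℝ) (hA : ∀ j, 0 ≤ A j) :
    homEntropy A = -∑ j, A j * Real.logb 2 (A j / ∑ i, A i) := by
  have h : ∀ j, A j * Real.logb 2 (A j / ∑ i, A i) =
      A j * Real.logb 2 (A j) - A j * Real.logb 2 (∑ i, A i) := by
    intro j
    rcases (hA j).eq_or_lt with h | h
    · simp [← h]
    · rw [Real.logb_div h.ne'
        (h.trans_le (Finset.single_le_sum (fun j _ => hA j) (Finset.mem_univ j))).ne', mul_sub]
  simp only [h, Finset.sum_sub_distrib, ← Finset.sum_mul, homEntropy, negMulLogb,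
    Finset.sum_neg_distrib]
  ring

theorem homEntropy_of_sum_eq_zero {A : ι → ℝ} (hA : ∀ j, 0 ≤ A j) (h : ∑ j, A j = 0) :
    homEntropy A = 0 := by
  simp [homEntropy_eq_neg_sum A hA, h]

/-- Concavity of Shannon entropy in homogeneous form. Gibbs' inequality is applied to every B l
against one common distribution, the normalized total; the resulting cross entropies are linear in B
l and add up to the entropy of the total. -/
theorem homEntropy_superadditive {κ : Type*} [Fintype κ] (B : κ → ι → ℝ)
    (hB : ∀ l j, 0 ≤ B l j) :
    ∑ l, homEntropy (B l) ≤ homEntropy fun j => ∑ l, B l j := by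
  set A : ι → ℝ := fun j => ∑ l, B l j with hA
  have hA0 : ∀ j, 0 ≤ A j := fun j => Finset.sum_nonneg fun l _ => hB l j
  rcases (Finset.sum_nonneg fun j (_ : j ∈ Finset.univ) => hA0 j).eq_or_lt with h | h
  · have hBz : ∀ l j, B l j = 0 := fun l j =>
      (Finset.sum_eq_zero_iff_of_nonneg fun l _ => hB l j).1
        ((Finset.sum_eq_zero_iff_of_nonneg fun j _ => hA0 j).1 h.symm j (Finset.mem_univ j)) l
        (Finset.mem_univ l)
    rw [homEntropy_of_sum_eq_zero hA0 h.symm]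
    refine (Finset.sum_eq_zero fun l _ => ?_).le
    exact homEntropy_of_sum_eq_zero (hB l) (Finset.sum_eq_zero fun j _ => hBz l j)
  · calc ∑ l, homEntropy (B l) ≤ ∑ l, -∑ j, B l j * Real.logb 2 (A j / ∑ i, A i) := by
          refine Finset.sum_le_sum fun l _ => homEntropy_le (hB l)
            (fun j => div_nonneg (hA0 j) h.le) ?_ fun j hj => ?_
          · rw [← Finset.sum_div, div_self h.ne']
          · have : A j = 0 := by simpa [h.ne'] using hj
            exact (Finset.sum_eq_zero_iff_of_nonneg fun l _ => hB l j).1 this l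
              (Finset.mem_univ l)
      _ = homEntropy A := by
          rw [homEntropy_eq_neg_sum A hA0, Finset.sum_neg_distrib, Finset.sum_comm]
          simp only [hA, Finset.sum_mul]

/-- With s = ∑ y, each γ y_j + β is the convex combination of β and γ s + β with weight y_j / s on
the latter, and these weights sum to 1. For a spiked operator this says that the diagonal in any
orthonormal basis has at least the entropy of the spectrum. -/
theorem sum_negMulLogb_ge {γ β : ℝ} (hβ : 0 ≤ β) (hγβ : 0 ≤ γ + β) {y : ι → ℝ}
    (hy : ∀ j, 0 ≤ y j) (hy1 : ∑ j, y j ≤ 1) :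
    negMulLogb (γ * ∑ j, y j + β) + ((Fintype.card ι : ℝ) - 1) * negMulLogb β ≤
      ∑ j, negMulLogb (γ * y j + β) := by
  rcases (Finset.sum_nonneg fun j (_ : j ∈ Finset.univ) => hy j).eq_or_lt with h | h
  · have hz : ∀ j, y j = 0 := fun j =>
      (Finset.sum_eq_zero_iff_of_nonneg fun j _ => hy j).1 h.symm j (Finset.mem_univ j)
    refine le_of_eq ?_
    simp [hz]
    ring
  · set s := ∑ j, y j
    -- For s in [0, 1] this value lies between β and γ + β, whatever the sign of γ.
    have hs : 0 ≤ γ * s + β := by nlinarith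
    have key : ∀ j, (1 - y j / s) * negMulLogb β + y j / s * negMulLogb (γ * s + β) ≤
        negMulLogb (γ * y j + β) := by
      intro j
      have hle : y j / s ≤ 1 :=
        (div_le_one h).2 (Finset.single_le_sum (fun j _ => hy j) (Finset.mem_univ j))
      have := concaveOn_negMulLogb.2 (Set.mem_Ici.2 hβ) (Set.mem_Ici.2 hs)
        (sub_nonneg.2 hle) (div_nonneg (hy j) h.le) (by ring)
      simp only [smul_eq_mul] at this
      refine this.trans_eq ?_
      congr 1
      field_simp
      ring
    refine le_trans (le_of_eq ?_) (Finset.sum_le_sum fun j _ => key j)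
    rw [Finset.sum_add_distrib, ← Finset.sum_mul, ← Finset.sum_mul, Finset.sum_sub_distrib,
      ← Finset.sum_div, div_self h.ne']
    simp
    ring

/-! ### Product vectors and partial traces -/

/-- The product vector `|v⟩|w⟩`. -/
def tensorVec (v : EuclideanSpace ℂ m) (w : EuclideanSpace ℂ n) : EuclideanSpace ℂ (m × n) :=
  WithLp.toLp 2 fun p => v p.1 * w p.2

theorem ketBra_tensorVec (v : EuclideanSpace ℂ m) (w : EuclideanSpace ℂ n) :
    ketBra (tensorVec v w) = ketBra v ⊗ₖ ketBra w := by
  ext ⟨x, y⟩ ⟨x', y'⟩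
  simp [ketBra, tensorVec, Matrix.vecMulVec_apply]
  ring

theorem inner_tensorVec (v v' : EuclideanSpace ℂ m) (w w' : EuclideanSpace ℂ n) :
    inner ℂ (tensorVec v w) (tensorVec v' w') = inner ℂ v v' * inner ℂ w w' := by
  simp only [PiLp.inner_apply, tensorVec, RCLike.inner_apply, Fintype.sum_prod_type, map_mul,
    Finset.sum_mul_sum]
  refine Finset.sum_congr rfl fun x _ => Finset.sum_congr rfl fun y _ => ?_
  ring

/-- Alice's basis may vary with Bob's index, as it must for the eigenbasis of a quantum-classical
state. Vectors with distinct Bob indices are orthogonal through η, the others through a single w k;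
the count equals the dimension. -/
theorem exists_orthonormalBasis_tensorVec (w : n → OrthonormalBasis m ℂ (EuclideanSpace ℂ m))
    (η : OrthonormalBasis n ℂ (EuclideanSpace ℂ n)) :
    ∃ e : OrthonormalBasis (m × n) ℂ (EuclideanSpace ℂ (m × n)),
      ∀ p, e p = tensorVec (w p.2 p.1) (η p.2) := by
  classical
  have ho : Orthonormal ℂ fun p : m × n => tensorVec (w p.2 p.1) (η p.2) := by
    rw [orthonormal_iff_ite]
    rintro ⟨x, y⟩ ⟨x', y'⟩
    rw [inner_tensorVec, η.inner_eq_ite]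
    by_cases h : y = y'
    · subst h
      simp [OrthonormalBasis.inner_eq_ite]
    · simp [h]
  obtain ⟨e, he⟩ := Orthonormal.exists_orthonormalBasis_extension_of_card_eq (𝕜 := ℂ)
    (E := EuclideanSpace ℂ (m × n)) (ι := m × n) (by simp)
    (v := fun p : m × n => tensorVec (w p.2 p.1) (η p.2)) (s := Set.univ)
    (ho.comp _ Subtype.val_injective)
  exact ⟨e, fun p => he p trivial⟩

/-- The vector `⟨v|ψ⟩` of Alice's space, `v` being a vector of Bob's. -/
def contract (v : EuclideanSpace ℂ n) (ψ : EuclideanSpace ℂ (m × n)) : EuclideanSpace ℂ m :=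
  WithLp.toLp 2 fun x => ∑ y, star (v y) * ψ (x, y)

theorem inner_tensorVec_left (w : EuclideanSpace ℂ m) (v : EuclideanSpace ℂ n)
    (ψ : EuclideanSpace ℂ (m × n)) :
    inner ℂ (tensorVec w v) ψ = inner ℂ w (contract v ψ) := by
  simp only [PiLp.inner_apply, tensorVec, contract, RCLike.inner_apply, Fintype.sum_prod_type,
    map_mul, Finset.sum_mul]
  refine Finset.sum_congr rfl fun x _ => Finset.sum_congr rfl fun y _ => ?_
  simp only [starRingEnd_apply]
  ring

/-! ### Partial traces and Alice's conditional states -/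

theorem traceB_add (M N : Matrix (m × n) (m × n) ℂ) : traceB (M + N) = traceB M + traceB N := by
  ext x x'
  simp [traceB, Finset.sum_add_distrib]

theorem traceB_smul (c : ℂ) (M : Matrix (m × n) (m × n) ℂ) : traceB (c • M) = c • traceB M := by
  ext x x'
  simp [traceB, Finset.mul_sum]

theorem traceB_sum {κ : Type*} (s : Finset κ) (M : κ → Matrix (m × n) (m × n) ℂ) :
    traceB (∑ i ∈ s, M i) = ∑ i ∈ s, traceB (M i) := by
  ext x x'
  simp only [traceB, Matrix.of_apply, Matrix.sum_apply]
  rw [Finset.sum_comm]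

theorem traceB_kronecker (M : Matrix m m ℂ) (N : Matrix n n ℂ) :
    traceB (M ⊗ₖ N) = N.trace • M := by
  ext x x'
  simp [traceB, Matrix.trace, ← Finset.mul_sum, mul_comm]

theorem traceA_add (M N : Matrix (m × n) (m × n) ℂ) : traceA (M + N) = traceA M + traceA N := by
  ext x x'
  simp [traceA, Finset.sum_add_distrib]

theorem traceA_smul (c : ℂ) (M : Matrix (m × n) (m × n) ℂ) : traceA (c • M) = c • traceA M := by
  ext x x'
  simp [traceA, Finset.mul_sum]

theorem traceA_sum {κ : Type*} (s : Finset κ) (M : κ → Matrix (m × n) (m × n) ℂ) :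
    traceA (∑ i ∈ s, M i) = ∑ i ∈ s, traceA (M i) := by
  ext x x'
  simp only [traceA, Matrix.of_apply, Matrix.sum_apply]
  rw [Finset.sum_comm]

theorem traceA_kronecker (M : Matrix m m ℂ) (N : Matrix n n ℂ) :
    traceA (M ⊗ₖ N) = M.trace • N := by
  ext x x'
  simp [traceA, Matrix.trace, ← Finset.sum_mul]

theorem trace_traceB (M : Matrix (m × n) (m × n) ℂ) : (traceB M).trace = M.trace := by
  simp [traceB, Matrix.trace, Fintype.sum_prod_type]

/-- Alice's unnormalized state after Bob has observed the effect `F`. -/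
def condState [DecidableEq m] (ρ : Matrix (m × n) (m × n) ℂ) (F : Matrix n n ℂ) : Matrix m m ℂ :=
  traceB (((1 : Matrix m m ℂ) ⊗ₖ F) * ρ)

theorem condState_apply [DecidableEq m] (ρ : Matrix (m × n) (m × n) ℂ) (F : Matrix n n ℂ)
    (x x' : m) : condState ρ F x x' = ∑ y, ∑ y', F y y' * ρ (x, y') (x', y) := by
  simp [condState, traceB, Matrix.mul_apply, Fintype.sum_prod_type, Matrix.one_apply]

theorem condState_sum_smul [DecidableEq m] (ρ : Matrix (m × n) (m × n) ℂ) (c : ι → ℂ)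
    (F : ι → Matrix n n ℂ) :
    condState ρ (∑ l, c l • F l) = ∑ l, c l • condState ρ (F l) := by
  ext x x'
  simp only [condState_apply, Matrix.sum_apply, Matrix.smul_apply, smul_eq_mul, Finset.sum_mul,
    Finset.mul_sum]
  rw [Finset.sum_comm_cycle]
  refine Finset.sum_congr rfl fun l _ => Finset.sum_congr rfl fun y _ =>
    Finset.sum_congr rfl fun y' _ => by ring

theorem outcomeProb_eq [DecidableEq m] (ρ : Matrix (m × n) (m × n) ℂ) (F : Matrix n n ℂ) :
    outcomeProb ρ F = (condState ρ F).trace.re := by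
  rw [outcomeProb, condState, trace_traceB]

theorem isHermitian_condState [DecidableEq m] {ρ : Matrix (m × n) (m × n) ℂ} {F : Matrix n n ℂ}
    (hρ : ρ.IsHermitian) (hF : F.IsHermitian) : (condState ρ F).IsHermitian := by
  ext x x'
  simp only [Matrix.conjTranspose_apply, condState_apply, star_sum, star_mul', hF.apply, hρ.apply]
  exact Finset.sum_comm

theorem expVal_condState_ketBra [DecidableEq m] (ρ : Matrix (m × n) (m × n) ℂ)
    (v : EuclideanSpace ℂ n) (w : EuclideanSpace ℂ m) :
    expVal (condState ρ (ketBra v)) w = expVal ρ (tensorVec w v) := by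
  simp only [expVal, dotProduct, Matrix.mulVec, condState_apply, tensorVec,
    Fintype.sum_prod_type, ketBra, Matrix.vecMulVec_apply, Pi.star_apply, Finset.mul_sum,
    Finset.sum_mul, star_mul']
  refine Finset.sum_congr rfl fun x _ => ?_
  refine Finset.sum_comm_cycle.trans ?_
  refine Finset.sum_congr rfl fun y _ => Finset.sum_congr rfl fun x' _ =>
    Finset.sum_congr rfl fun y' _ => ?_
  ring

theorem condState_ketBra_ketBra [DecidableEq m] (ψ : EuclideanSpace ℂ (m × n))
    (v : EuclideanSpace ℂ n) : condState (ketBra ψ) (ketBra v) = ketBra (contract v ψ) := by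
  ext x x'
  simp only [condState_apply, ketBra, Matrix.vecMulVec_apply, Pi.star_apply, contract, star_sum,
    star_mul', star_star, Finset.sum_mul_sum]
  rw [Finset.sum_comm]
  refine Finset.sum_congr rfl fun x _ => Finset.sum_congr rfl fun y _ => by ring

theorem condState_one [DecidableEq m] [DecidableEq n] (F : Matrix n n ℂ) :
    condState (1 : Matrix (m × n) (m × n) ℂ) F = F.trace • 1 := by
  rw [condState, mul_one, traceB_kronecker]

theorem condState_add [DecidableEq m] (ρ σ : Matrix (m × n) (m × n) ℂ) (F : Matrix n n ℂ) :
    condState (ρ + σ) F = condState ρ F + condState σ F := by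
  rw [condState, mul_add, traceB_add]; rfl

theorem condState_smul [DecidableEq m] (c : ℂ) (ρ : Matrix (m × n) (m × n) ℂ)
    (F : Matrix n n ℂ) : condState (c • ρ) F = c • condState ρ F := by
  rw [condState, Matrix.mul_smul, traceB_smul]; rfl

theorem postState_eq [DecidableEq m] (ρ : Matrix (m × n) (m × n) ℂ) (F : Matrix n n ℂ) :
    postState ρ F = ((outcomeProb ρ F : ℂ))⁻¹ • condState ρ F := rfl

/-- Homogeneity of `homEntropy` absorbs the normalization by p, so that the unnormalized conditional
state suffices. For p = 0 both sides are zero. -/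
theorem outcomeProb_mul_entropy_postState [DecidableEq m] {ρ : Matrix (m × n) (m × n) ℂ}
    {F : Matrix n n ℂ} (w : OrthonormalBasis ι ℂ (EuclideanSpace ℂ m)) {A : ι → ℝ}
    (hA : ∀ j, 0 ≤ A j) (h : condState ρ F = ∑ j, (A j : ℂ) • ketBra (w j)) :
    outcomeProb ρ F * entropy (postState ρ F) = homEntropy A := by
  have hp : outcomeProb ρ F = ∑ j, A j := by rw [outcomeProb_eq, h, trace_sum_smul_ketBra]
  by_cases h0 : ∑ j, A j = 0
  · rw [hp, h0, zero_mul, homEntropy_of_sum_eq_zero hA h0]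
  · have hps : postState ρ F = ∑ j, (((∑ j, A j)⁻¹ * A j : ℝ) : ℂ) • ketBra (w j) := by
      rw [postState_eq, h, hp, Finset.smul_sum]
      refine Finset.sum_congr rfl fun j _ => ?_
      rw [smul_smul]
      push_cast
      rfl
    have hh := homEntropy_smul (∑ j, A j)⁻¹ A
    rw [homEntropy, ← Finset.mul_sum, inv_mul_cancel₀ h0, negMulLogb_one, sub_zero] at hh
    rw [hp, hps, entropy_sum_smul_ketBra, hh, mul_inv_cancel_left₀ h0]

/-! ### Schmidt decompositions -/

theorem IsSchmidtDecomposition.contract_eq {ψ : EuclideanSpace ℂ (n × n)} {u : n → ℝ}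
    {a b : OrthonormalBasis n ℂ (EuclideanSpace ℂ n)} (hS : IsSchmidtDecomposition ψ u a b)
    (v : EuclideanSpace ℂ n) :
    contract v ψ = ∑ i, ((u i : ℂ) * inner ℂ v (b i)) • a i := by
  ext x
  simp only [contract, hS.2, WithLp.ofLp_sum, WithLp.ofLp_smul, Finset.sum_apply, Pi.smul_apply,
    smul_eq_mul, PiLp.inner_apply, RCLike.inner_apply, Finset.mul_sum, Finset.sum_mul]
  rw [Finset.sum_comm]
  refine Finset.sum_congr rfl fun i _ => Finset.sum_congr rfl fun y _ => ?_
  simp only [starRingEnd_apply]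
  ring

/-- For a unit vector v the right side is a weighted mean of the u_i²: the input for every use of
Jensen below. -/
theorem IsSchmidtDecomposition.norm_contract_sq {ψ : EuclideanSpace ℂ (n × n)} {u : n → ℝ}
    {a b : OrthonormalBasis n ℂ (EuclideanSpace ℂ n)} (hS : IsSchmidtDecomposition ψ u a b)
    (v : EuclideanSpace ℂ n) :
    ‖contract v ψ‖ ^ 2 = ∑ i, ‖inner ℂ (b i) v‖ ^ 2 * u i ^ 2 := by
  rw [← a.sum_sq_norm_inner_right]
  refine Finset.sum_congr rfl fun i _ => ?_
  rw [hS.contract_eq, a.orthonormal.inner_right_fintype, norm_mul, mul_pow, Complex.norm_real,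
    norm_inner_symm, Real.norm_eq_abs, sq_abs, mul_comm]

theorem IsSchmidtDecomposition.inner_tensorVec {ψ : EuclideanSpace ℂ (n × n)} {u : n → ℝ}
    {a b : OrthonormalBasis n ℂ (EuclideanSpace ℂ n)} (hS : IsSchmidtDecomposition ψ u a b)
    (i j : n) [Decidable (i = j)] :
    inner ℂ (tensorVec (a i) (b j)) ψ = if i = j then (u i : ℂ) else 0 := by
  classical
  rw [inner_tensorVec_left, hS.contract_eq, a.orthonormal.inner_right_fintype, b.inner_eq_ite]
  by_cases h : i = j
  · subst h; simp
  · simp [h, Ne.symm h]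

theorem IsSchmidtDecomposition.sum_sq {ψ : EuclideanSpace ℂ (n × n)} {u : n → ℝ}
    {a b : OrthonormalBasis n ℂ (EuclideanSpace ℂ n)} (hS : IsSchmidtDecomposition ψ u a b) :
    ∑ i, u i ^ 2 = ‖ψ‖ ^ 2 := by
  classical
  obtain ⟨e, he⟩ := exists_orthonormalBasis_tensorVec (fun _ => a) b
  rw [← e.sum_sq_norm_inner_right, Fintype.sum_prod_type]
  refine Finset.sum_congr rfl fun i _ => ?_
  rw [Finset.sum_eq_single i]
  · rw [he, hS.inner_tensorVec]
    simp
  · intro j _ hj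
    rw [he, hS.inner_tensorVec]
    simp [Ne.symm hj]
  · simp

theorem _root_.OrthonormalBasis.sum_mul_star_eq (b : OrthonormalBasis n ℂ (EuclideanSpace ℂ n))
    [DecidableEq n] (i j : n) : ∑ y, b i y * star (b j y) = if i = j then 1 else 0 := by
  have := b.inner_eq_ite j i
  simp only [PiLp.inner_apply, RCLike.inner_apply] at this
  simpa [eq_comm] using this

theorem IsSchmidtDecomposition.traceB_ketBra {ψ : EuclideanSpace ℂ (n × n)} {u : n → ℝ}
    {a b : OrthonormalBasis n ℂ (EuclideanSpace ℂ n)} (hS : IsSchmidtDecomposition ψ u a b) :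
    traceB (ketBra ψ) = ∑ i, ((u i ^ 2 : ℝ) : ℂ) • ketBra (a i) := by
  classical
  ext x x'
  have h : traceB (ketBra ψ) x x' = ∑ i, ∑ j, (u i : ℂ) * u j * (a i x * star (a j x')) *
      ∑ y, b i y * star (b j y) := by
    simp only [traceB, Matrix.of_apply, ketBra, Matrix.vecMulVec_apply, Pi.star_apply, hS.2,
      star_sum, star_mul', Finset.sum_mul_sum]
    simp only [Finset.mul_sum]
    rw [Finset.sum_comm]
    refine Finset.sum_congr rfl fun i _ => ?_
    rw [Finset.sum_comm]
    refine Finset.sum_congr rfl fun j _ => Finset.sum_congr rfl fun y _ => ?_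
    simp
    ring
  rw [h]
  simp only [OrthonormalBasis.sum_mul_star_eq, Matrix.sum_apply]
  refine Finset.sum_congr rfl fun i _ => ?_
  simp [ketBra, Matrix.vecMulVec_apply, pow_two]

theorem IsSchmidtDecomposition.traceA_ketBra {ψ : EuclideanSpace ℂ (n × n)} {u : n → ℝ}
    {a b : OrthonormalBasis n ℂ (EuclideanSpace ℂ n)} (hS : IsSchmidtDecomposition ψ u a b) :
    traceA (ketBra ψ) = ∑ i, ((u i ^ 2 : ℝ) : ℂ) • ketBra (b i) := by
  classical
  ext y y'
  have h : traceA (ketBra ψ) y y' = ∑ i, ∑ j, (u i : ℂ) * u j * (b i y * star (b j y')) *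
      ∑ x, a i x * star (a j x) := by
    simp only [traceA, Matrix.of_apply, ketBra, Matrix.vecMulVec_apply, Pi.star_apply, hS.2,
      star_sum, star_mul', Finset.sum_mul_sum]
    simp only [Finset.mul_sum]
    rw [Finset.sum_comm]
    refine Finset.sum_congr rfl fun i _ => ?_
    rw [Finset.sum_comm]
    refine Finset.sum_congr rfl fun j _ => Finset.sum_congr rfl fun y _ => ?_
    simp
    ring
  rw [h]
  simp only [OrthonormalBasis.sum_mul_star_eq, Matrix.sum_apply]
  refine Finset.sum_congr rfl fun i _ => ?_
  simp [ketBra, Matrix.vecMulVec_apply, pow_two]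

/-- Comparison of coordinates in the basis b. It describes eigenvectors without separating out
degenerate eigenvalues. -/
theorem sum_smul_ketBra_mulVec_eq_smul_iff (b : OrthonormalBasis ι ℂ (EuclideanSpace ℂ n))
    (q : ι → ℂ) (v : EuclideanSpace ℂ n) (c : ℂ) :
    (∑ i, q i • ketBra (b i)) *ᵥ v.ofLp = c • v.ofLp ↔
      ∀ i, inner ℂ (b i) v ≠ 0 → q i = c := by
  have h1 : (∑ i, q i • ketBra (b i)) *ᵥ v.ofLp =
      (∑ i, (q i * inner ℂ (b i) v) • b i : EuclideanSpace ℂ n).ofLp := by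
    simp [Matrix.sum_mulVec, Matrix.smul_mulVec, ketBra_mulVec, smul_smul]
  have h2 : c • v.ofLp = (∑ i, (c * inner ℂ (b i) v) • b i : EuclideanSpace ℂ n).ofLp := by
    conv_lhs => rw [← b.sum_repr' v]
    simp [Finset.smul_sum, smul_smul]
  rw [h1, h2, (WithLp.ofLp_injective 2).eq_iff]
  constructor
  · intro h i hi
    have := congrArg (fun z => inner ℂ (b i) z) h
    simp only [b.orthonormal.inner_right_fintype] at this
    exact mul_right_cancel₀ hi this
  · intro h
    refine Finset.sum_congr rfl fun i _ => ?_
    by_cases hi : inner ℂ (b i) v = 0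
    · simp [hi]
    · rw [h i hi]

/-! ### Rank-one perturbations of multiples of the identity -/

/-- The operator `γ|ψ⟩⟨ψ| + β`. -/
def spiked [DecidableEq n] (γ β : ℝ) (ψ : EuclideanSpace ℂ n) : Matrix n n ℂ :=
  (γ : ℂ) • ketBra ψ + (β : ℂ) • 1

theorem isHermitian_spiked [DecidableEq n] (γ β : ℝ) (ψ : EuclideanSpace ℂ n) :
    (spiked γ β ψ).IsHermitian := by
  rw [Matrix.IsHermitian, spiked, Matrix.conjTranspose_add, Matrix.conjTranspose_smul,
    Matrix.conjTranspose_smul, (ketBra_isHermitian ψ).eq, Matrix.conjTranspose_one]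
  simp

theorem expVal_spiked [DecidableEq n] (γ β : ℝ) (ψ : EuclideanSpace ℂ n)
    {v : EuclideanSpace ℂ n} (hv : ‖v‖ = 1) :
    expVal (spiked γ β ψ) v = (γ * ‖inner ℂ v ψ‖ ^ 2 + β : ℝ) := by
  rw [spiked, expVal_add, expVal_smul, expVal_smul, expVal_ketBra, expVal_one, hv,
    norm_inner_symm]
  push_cast
  ring

theorem sum_ite_eq_add [DecidableEq n] (i : n) (p q : ℝ) :
    ∑ j, (if j = i then p else q) = p + ((Fintype.card n : ℝ) - 1) * q := by
  rw [← Finset.add_sum_erase _ _ (Finset.mem_univ i), if_pos rfl,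
    Finset.sum_congr rfl fun j hj => if_neg (Finset.ne_of_mem_erase hj)]
  rw [Finset.sum_const, Finset.card_erase_of_mem (Finset.mem_univ i), Finset.card_univ,
    nsmul_eq_mul, Nat.cast_sub (Fintype.card_pos_iff.2 ⟨i⟩)]
  simp

theorem entropy_spiked [DecidableEq n] [Nonempty n] (γ β : ℝ) {ψ : EuclideanSpace ℂ n}
    (hψ : ‖ψ‖ = 1) :
    entropy (spiked γ β ψ) =
      negMulLogb (γ + β) + ((Fintype.card n : ℝ) - 1) * negMulLogb β := by
  obtain ⟨e, i, h⟩ := smul_ketBra_add_smul_one ψ γ β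
  rw [spiked, h, entropy_sum_smul_ketBra, ← sum_ite_eq_add i]
  refine Finset.sum_congr rfl fun j _ => ?_
  rw [apply_ite negMulLogb, hψ, one_pow, mul_one]

/-- The contribution `p S(ρ^A)` of the outcome `|v⟩⟨v|` to the conditional entropy of
`γ|ψ⟩⟨ψ| + β`, as a function of `x = ‖⟨v|ψ⟩‖²`. -/
def profile (d γ β x : ℝ) : ℝ :=
  negMulLogb (γ * x + β) + (d - 1) * negMulLogb β - negMulLogb (γ * x + d * β)

/-- Exhibits `profile` as the concave shift difference with c = (d - 1)β at the point γ x + β, plus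
a constant. -/
theorem profile_eq (d γ β x : ℝ) :
    profile d γ β x = (negMulLogb (γ * x + β) - negMulLogb (γ * x + β + (d - 1) * β)) +
      (d - 1) * negMulLogb β := by
  rw [profile, show γ * x + β + (d - 1) * β = γ * x + d * β by ring]
  ring

theorem affine_nonneg {γ β x : ℝ} (hβ : 0 ≤ β) (hγβ : 0 ≤ γ + β) (hx0 : 0 ≤ x) (hx1 : x ≤ 1) :
    0 ≤ γ * x + β := by nlinarith

theorem sum_weight_affine {W x : ι → ℝ} (hW1 : ∑ i, W i = 1) (γ β : ℝ) :
    ∑ i, W i • (γ * x i + β) = γ * ∑ i, W i * x i + β := by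
  simp only [smul_eq_mul, mul_add, Finset.sum_add_distrib, ← Finset.sum_mul, hW1, Finset.mul_sum]
  rw [one_mul]
  congr 1
  exact Finset.sum_congr rfl fun i _ => by ring

theorem sum_mul_profile_le {d γ β : ℝ} (hd : 1 ≤ d) (hβ : 0 ≤ β) (hγβ : 0 ≤ γ + β)
    {W x : ι → ℝ} (hW : ∀ i, 0 ≤ W i) (hW1 : ∑ i, W i = 1) (hx0 : ∀ i, 0 ≤ x i)
    (hx1 : ∀ i, x i ≤ 1) :
    ∑ i, W i * profile d γ β (x i) ≤ profile d γ β (∑ i, W i * x i) := by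
  have h := (concaveOn_negMulLogb_sub_shift (c := (d - 1) * β)
    (mul_nonneg (by linarith) hβ)).le_map_sum (t := Finset.univ) (w := W)
    (p := fun i => γ * x i + β) (fun i _ => hW i) hW1
    (fun i _ => affine_nonneg hβ hγβ (hx0 i) (hx1 i))
  rw [sum_weight_affine hW1] at h
  simp only [profile_eq, mul_add, Finset.sum_add_distrib, ← Finset.sum_mul, hW1, one_mul]
  simpa using h

/-- Equality in strict Jensen identifies the points γ x_i + β. The factor γ cannot be cancelled, as
γ = 0 is allowed, but the eigenvalues of ρ^B involve only γ u_i². -/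
theorem eq_of_profile_le_sum {d γ β : ℝ} (hd : 1 < d) (hβ : 0 < β) (hγβ : 0 ≤ γ + β)
    {W x : ι → ℝ} (hW : ∀ i, 0 ≤ W i) (hW1 : ∑ i, W i = 1) (hx0 : ∀ i, 0 ≤ x i)
    (hx1 : ∀ i, x i ≤ 1)
    (h : profile d γ β (∑ i, W i * x i) ≤ ∑ i, W i * profile d γ β (x i)) {i : ι}
    (hi : W i ≠ 0) : γ * x i = γ * ∑ i, W i * x i := by
  have key := (strictConcaveOn_negMulLogb_sub_shift (c := (d - 1) * β)
    (mul_pos (by linarith) hβ)).map_sum_eq_iff' (t := Finset.univ) (w := W)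
    (p := fun i => γ * x i + β) (fun i _ => hW i) hW1
    (fun i _ => affine_nonneg hβ.le hγβ (hx0 i) (hx1 i))
  rw [sum_weight_affine hW1] at key
  have h' := le_antisymm h (sum_mul_profile_le hd.le hβ.le hγβ hW hW1 hx0 hx1)
  simp only [profile_eq, mul_add, Finset.sum_add_distrib, ← Finset.sum_mul, hW1, one_mul,
    add_left_inj] at h'
  have := key.1 (by simpa using h') i (Finset.mem_univ i) hi
  simpa using this

theorem homEntropy_affine_ge {γ β : ℝ} (hβ : 0 ≤ β) (hγβ : 0 ≤ γ + β) {y : ι → ℝ}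
    (hy : ∀ j, 0 ≤ y j) (hy1 : ∑ j, y j ≤ 1) :
    profile (Fintype.card ι) γ β (∑ j, y j) ≤ homEntropy fun j => γ * y j + β := by
  have := sum_negMulLogb_ge hβ hγβ hy hy1
  rw [homEntropy, Finset.sum_add_distrib, ← Finset.mul_sum, Finset.sum_const, Finset.card_univ,
    nsmul_eq_mul, profile]
  linarith

theorem outcomeProb_mul_entropy_spiked [DecidableEq m] [DecidableEq n] [Nonempty m] {γ β : ℝ}
    (hβ : 0 ≤ β) (hγβ : 0 ≤ γ + β) {ψ : EuclideanSpace ℂ (m × n)} {v : EuclideanSpace ℂ n}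
    (hv : ‖v‖ = 1) (hψv : ‖contract v ψ‖ ^ 2 ≤ 1) :
    outcomeProb (spiked γ β ψ) (ketBra v) * entropy (postState (spiked γ β ψ) (ketBra v)) =
      profile (Fintype.card m) γ β (‖contract v ψ‖ ^ 2) := by
  obtain ⟨e, i, h⟩ := smul_ketBra_add_smul_one (contract v ψ) γ β
  rw [outcomeProb_mul_entropy_postState e
    (A := fun j => if j = i then γ * ‖contract v ψ‖ ^ 2 + β else β)]
  · rw [homEntropy, sum_ite_eq_add]
    simp only [apply_ite negMulLogb]
    rw [sum_ite_eq_add, profile]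
    congr 2
    ring
  · intro j
    split_ifs
    · exact affine_nonneg hβ hγβ (by positivity) hψv
    · exact hβ
  · rw [spiked, condState_add, condState_smul, condState_smul, condState_ketBra_ketBra,
      condState_one, trace_ketBra, hv, ← h]
    simp

/-! ### Optimal measurements -/

theorem IsSchmidtDecomposition.sq_le_one {ψ : EuclideanSpace ℂ (n × n)} {u : n → ℝ}
    {a b : OrthonormalBasis n ℂ (EuclideanSpace ℂ n)} (hS : IsSchmidtDecomposition ψ u a b)
    (hψ : ‖ψ‖ = 1) (i : n) : u i ^ 2 ≤ 1 := by
  have := hS.sum_sq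
  rw [hψ, one_pow] at this
  rw [← this]
  exact Finset.single_le_sum (f := fun i => u i ^ 2) (fun j _ => sq_nonneg _) (Finset.mem_univ i)

theorem IsSchmidtDecomposition.norm_contract_sq_le {ψ : EuclideanSpace ℂ (n × n)} {u : n → ℝ}
    {a b : OrthonormalBasis n ℂ (EuclideanSpace ℂ n)} (hS : IsSchmidtDecomposition ψ u a b)
    (hψ : ‖ψ‖ = 1) {v : EuclideanSpace ℂ n} (hv : ‖v‖ = 1) : ‖contract v ψ‖ ^ 2 ≤ 1 := by
  have h := b.sum_sq_norm_inner_right v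
  rw [hv, one_pow] at h
  rw [hS.norm_contract_sq, ← h]
  exact Finset.sum_le_sum fun i _ =>
    mul_le_of_le_one_right (sq_nonneg _) (hS.sq_le_one hψ i)

theorem sum_mul_profile_le_profile_contract {d γ β : ℝ} (hd : 1 ≤ d) (hβ : 0 ≤ β)
    (hγβ : 0 ≤ γ + β) {ψ : EuclideanSpace ℂ (n × n)} {u : n → ℝ}
    {a b : OrthonormalBasis n ℂ (EuclideanSpace ℂ n)} (hS : IsSchmidtDecomposition ψ u a b)
    (hψ : ‖ψ‖ = 1) {v : EuclideanSpace ℂ n} (hv : ‖v‖ = 1) :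
    ∑ i, ‖inner ℂ (b i) v‖ ^ 2 * profile d γ β (u i ^ 2) ≤
      profile d γ β (‖contract v ψ‖ ^ 2) := by
  rw [hS.norm_contract_sq]
  exact sum_mul_profile_le hd hβ hγβ (fun i => sq_nonneg _)
    (by rw [b.sum_sq_norm_inner_right, hv, one_pow]) (fun i => sq_nonneg _) (hS.sq_le_one hψ)

/-- Matrix concavity of the entropy is avoided by working in the eigenbasis w of the conditional
state of F. Its eigenvalues are sums, over the spectral decomposition of F, of diagonal entries in w
of rank-one conditional states; the scalar inequalities `homEntropy_superadditive` and
`homEntropy_affine_ge` then apply, followed by Jensen. -/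
theorem outcomeProb_mul_entropy_spiked_ge [DecidableEq n] [Nonempty n] {γ β : ℝ}
    (hβ : 0 ≤ β) (hγβ : 0 ≤ γ + β) {ψ : EuclideanSpace ℂ (n × n)} {u : n → ℝ}
    {a b : OrthonormalBasis n ℂ (EuclideanSpace ℂ n)} (hS : IsSchmidtDecomposition ψ u a b)
    (hψ : ‖ψ‖ = 1) {F : Matrix n n ℂ} (hF : F.PosSemidef) :
    ∑ i, (expVal F (b i)).re * profile (Fintype.card n) γ β (u i ^ 2) ≤
      outcomeProb (spiked γ β ψ) F * entropy (postState (spiked γ β ψ) F) := by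
  set ρ := spiked γ β ψ with hρ
  have hd : (1 : ℝ) ≤ Fintype.card n := by exact_mod_cast Fintype.card_pos
  set v := hF.isHermitian.eigenvectorBasis
  set e := hF.isHermitian.eigenvalues
  have he : ∀ l, 0 ≤ e l := hF.eigenvalues_nonneg
  have hFe : F = ∑ l, (e l : ℂ) • ketBra (v l) :=
    hF.isHermitian.eq_sum_eigenvalues_smul_ketBra
  have hT : (condState ρ F).IsHermitian :=
    isHermitian_condState (isHermitian_spiked γ β ψ) hF.isHermitian
  set w := hT.eigenvectorBasis
  have hTw : condState ρ F = ∑ j, (hT.eigenvalues j : ℂ) • ketBra (w j) :=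
    hT.eq_sum_eigenvalues_smul_ketBra
  set y : n → n → ℝ := fun l j => ‖inner ℂ (w j) (contract (v l) ψ)‖ ^ 2 with hy
  have hysum : ∀ l, ∑ j, y l j = ‖contract (v l) ψ‖ ^ 2 := fun l =>
    w.sum_sq_norm_inner_right _
  have hyle : ∀ l, ∑ j, y l j ≤ 1 := fun l => by
    rw [hysum]
    exact hS.norm_contract_sq_le hψ (v.norm_eq_one l)
  have hB : ∀ l j, 0 ≤ γ * y l j + β := fun l j =>
    affine_nonneg hβ hγβ (sq_nonneg _) ((Finset.single_le_sum
      (f := y l) (fun j _ => sq_nonneg _) (Finset.mem_univ j)).trans (hyle l))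
  have hA : ∀ j, hT.eigenvalues j = ∑ l, e l * (γ * y l j + β) := by
    intro j
    have h1 : expVal (condState ρ F) (w j) = hT.eigenvalues j := by
      conv_lhs => rw [hTw]
      exact expVal_sum_smul_ketBra w _ j
    have h2 : expVal (condState ρ F) (w j) = (∑ l, e l * (γ * y l j + β) : ℝ) := by
      conv_lhs => rw [hFe]
      rw [condState_sum_smul, expVal_sum, Complex.ofReal_sum]
      refine Finset.sum_congr rfl fun l _ => ?_
      have hn : ‖tensorVec (w j) (v l)‖ = 1 := by
        have : inner ℂ (tensorVec (w j) (v l)) (tensorVec (w j) (v l)) = (1 : ℂ) := by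
          rw [inner_tensorVec]
          simp
        rw [@norm_eq_sqrt_re_inner ℂ, this]
        simp
      rw [expVal_smul, expVal_condState_ketBra, hρ, expVal_spiked _ _ _ hn, inner_tensorVec_left]
      exact (Complex.ofReal_mul _ _).symm
    exact_mod_cast h1.symm.trans h2
  have hA0 : ∀ j, 0 ≤ hT.eigenvalues j := fun j => by
    rw [hA]
    exact Finset.sum_nonneg fun l _ => mul_nonneg (he l) (hB l j)
  rw [outcomeProb_mul_entropy_postState w hA0 hTw, funext hA]
  calc ∑ i, (expVal F (b i)).re * profile (Fintype.card n) γ β (u i ^ 2)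
      = ∑ l, e l * ∑ i, ‖inner ℂ (b i) (v l)‖ ^ 2 * profile (Fintype.card n) γ β (u i ^ 2) := by
        have : ∀ i, (expVal F (b i)).re = ∑ l, e l * ‖inner ℂ (b i) (v l)‖ ^ 2 := by
          intro i
          conv_lhs => rw [hFe]
          rw [expVal_sum, Complex.re_sum]
          refine Finset.sum_congr rfl fun l _ => ?_
          rw [expVal_smul, expVal_ketBra, norm_inner_symm, Complex.re_ofReal_mul,
            Complex.ofReal_re]
        simp only [this, Finset.sum_mul, Finset.mul_sum]
        rw [Finset.sum_comm]
        exact Finset.sum_congr rfl fun l _ => Finset.sum_congr rfl fun i _ => by ring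
    _ ≤ ∑ l, e l * homEntropy fun j => γ * y l j + β := by
        refine Finset.sum_le_sum fun l _ => mul_le_mul_of_nonneg_left ?_ (he l)
        refine le_trans ?_ (homEntropy_affine_ge hβ hγβ (fun j => sq_nonneg _) (hyle l))
        rw [hysum]
        exact sum_mul_profile_le_profile_contract hd hβ hγβ hS hψ (v.norm_eq_one l)
    _ = ∑ l, homEntropy fun j => e l * (γ * y l j + β) := by
        simp only [homEntropy_smul]
    _ ≤ _ := homEntropy_superadditive _ fun l j => mul_nonneg (he l) (hB l j)

/-- The weights ⟨b_i|E_k|b_i⟩ from the single-effect bound sum to 1 over k. -/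
theorem sum_profile_le_condEntropy [DecidableEq n] [Nonempty n] {γ β : ℝ}
    (hβ : 0 ≤ β) (hγβ : 0 ≤ γ + β) {ψ : EuclideanSpace ℂ (n × n)} {u : n → ℝ}
    {a b : OrthonormalBasis n ℂ (EuclideanSpace ℂ n)} (hS : IsSchmidtDecomposition ψ u a b)
    (hψ : ‖ψ‖ = 1) {E : ι → Matrix n n ℂ} (hE : IsPOVM E) :
    ∑ i, profile (Fintype.card n) γ β (u i ^ 2) ≤ condEntropy (spiked γ β ψ) E := by
  refine le_trans (le_of_eq ?_) (Finset.sum_le_sum fun k _ =>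
    outcomeProb_mul_entropy_spiked_ge hβ hγβ hS hψ (hE.1 k))
  rw [Finset.sum_comm]
  refine Finset.sum_congr rfl fun i _ => ?_
  rw [← Finset.sum_mul, ← Complex.re_sum, ← expVal_sum, hE.2, expVal_one, b.norm_eq_one]
  simp

theorem isPOVM_basisMeasurement [DecidableEq n]
    (e : OrthonormalBasis n ℂ (EuclideanSpace ℂ n)) : IsPOVM (basisMeasurement e) :=
  ⟨fun i => ketBra_posSemidef (e i), sum_ketBra e⟩

theorem condEntropy_spiked_basisMeasurement [DecidableEq n] [Nonempty n] {γ β : ℝ}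
    (hβ : 0 ≤ β) (hγβ : 0 ≤ γ + β) {ψ : EuclideanSpace ℂ (n × n)} {u : n → ℝ}
    {a b : OrthonormalBasis n ℂ (EuclideanSpace ℂ n)} (hS : IsSchmidtDecomposition ψ u a b)
    (hψ : ‖ψ‖ = 1) (e : OrthonormalBasis n ℂ (EuclideanSpace ℂ n)) :
    condEntropy (spiked γ β ψ) (basisMeasurement e) =
      ∑ k, profile (Fintype.card n) γ β (‖contract (e k) ψ‖ ^ 2) :=
  Finset.sum_congr rfl fun k _ => outcomeProb_mul_entropy_spiked hβ hγβ (e.norm_eq_one k)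
    (hS.norm_contract_sq_le hψ (e.norm_eq_one k))

theorem traceA_spiked [DecidableEq n] (γ β : ℝ) {ψ : EuclideanSpace ℂ (n × n)} {u : n → ℝ}
    {a b : OrthonormalBasis n ℂ (EuclideanSpace ℂ n)} (hS : IsSchmidtDecomposition ψ u a b) :
    traceA (spiked γ β ψ) =
      ∑ i, ((γ * u i ^ 2 + Fintype.card n * β : ℝ) : ℂ) • ketBra (b i) := by
  rw [spiked, traceA_add, traceA_smul, traceA_smul, hS.traceA_ketBra, ← Matrix.one_kronecker_one,
    traceA_kronecker, Matrix.trace_one, ← sum_ketBra b, Finset.smul_sum, Finset.smul_sum,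
    Finset.smul_sum, ← Finset.sum_add_distrib]
  refine Finset.sum_congr rfl fun i _ => ?_
  rw [smul_smul, smul_smul, ← add_smul]
  congr 1
  push_cast
  ring

theorem traceB_spiked [DecidableEq n] (γ β : ℝ) {ψ : EuclideanSpace ℂ (n × n)} {u : n → ℝ}
    {a b : OrthonormalBasis n ℂ (EuclideanSpace ℂ n)} (hS : IsSchmidtDecomposition ψ u a b) :
    traceB (spiked γ β ψ) =
      ∑ i, ((γ * u i ^ 2 + Fintype.card n * β : ℝ) : ℂ) • ketBra (a i) := by
  rw [spiked, traceB_add, traceB_smul, traceB_smul, hS.traceB_ketBra, ← Matrix.one_kronecker_one,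
    traceB_kronecker, Matrix.trace_one, ← sum_ketBra a, Finset.smul_sum, Finset.smul_sum,
    Finset.smul_sum, ← Finset.sum_add_distrib]
  refine Finset.sum_congr rfl fun i _ => ?_
  rw [smul_smul, smul_smul, ← add_smul]
  congr 1
  push_cast
  ring

theorem isEigenbasis_traceA_spiked [DecidableEq n] (γ β : ℝ) {ψ : EuclideanSpace ℂ (n × n)}
    {u : n → ℝ} {a b : OrthonormalBasis n ℂ (EuclideanSpace ℂ n)}
    (hS : IsSchmidtDecomposition ψ u a b) : IsEigenbasis (traceA (spiked γ β ψ)) b := fun i => by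
  rw [traceA_spiked γ β hS]
  exact ⟨_, sum_smul_ketBra_mulVec b _ i⟩

/-- An eigenvector of ρ^B is supported on those b_i that share one value of γ u_i². Since `profile`
sees x only through γ x, Jensen is an equality on each basis vector. -/
theorem condEntropy_spiked_of_isEigenbasis [DecidableEq n] [Nonempty n] {γ β : ℝ}
    (hβ : 0 ≤ β) (hγβ : 0 ≤ γ + β) {ψ : EuclideanSpace ℂ (n × n)} {u : n → ℝ}
    {a b : OrthonormalBasis n ℂ (EuclideanSpace ℂ n)} (hS : IsSchmidtDecomposition ψ u a b)
    (hψ : ‖ψ‖ = 1) {e : OrthonormalBasis n ℂ (EuclideanSpace ℂ n)}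
    (he : IsEigenbasis (traceA (spiked γ β ψ)) e) :
    condEntropy (spiked γ β ψ) (basisMeasurement e) =
      ∑ i, profile (Fintype.card n) γ β (u i ^ 2) := by
  rw [condEntropy_spiked_basisMeasurement hβ hγβ hS hψ]
  have hk : ∀ k, profile (Fintype.card n) γ β (‖contract (e k) ψ‖ ^ 2) =
      ∑ i, ‖inner ℂ (b i) (e k)‖ ^ 2 * profile (Fintype.card n) γ β (u i ^ 2) := by
    intro k
    obtain ⟨c, hc⟩ := he k
    rw [traceA_spiked γ β hS, sum_smul_ketBra_mulVec_eq_smul_iff] at hc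
    have hc' : ∀ i, inner ℂ (b i) (e k) ≠ 0 → γ * u i ^ 2 = c.re - Fintype.card n * β := by
      intro i hi
      rw [← hc i hi, Complex.ofReal_re]
      ring
    have hW : ∑ i, ‖inner ℂ (b i) (e k)‖ ^ 2 = 1 := by
      rw [b.sum_sq_norm_inner_right, e.norm_eq_one, one_pow]
    have hx : γ * ‖contract (e k) ψ‖ ^ 2 = c.re - Fintype.card n * β := by
      rw [hS.norm_contract_sq, Finset.mul_sum, ← one_mul (c.re - _), ← hW, Finset.sum_mul]
      refine Finset.sum_congr rfl fun i _ => ?_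
      by_cases hi : inner ℂ (b i) (e k) = 0
      · simp [hi]
      · rw [← hc' i hi]
        ring
    rw [← one_mul (profile _ _ _ _), ← hW, Finset.sum_mul]
    refine Finset.sum_congr rfl fun i _ => ?_
    by_cases hi : inner ℂ (b i) (e k) = 0
    · simp [hi]
    · simp only [profile, hx, hc' i hi]
  simp only [hk]
  rw [Finset.sum_comm]
  refine Finset.sum_congr rfl fun i _ => ?_
  rw [← Finset.sum_mul, e.sum_sq_norm_inner_left, b.norm_eq_one, one_pow, one_mul]

theorem isEigenbasis_of_condEntropy_le [DecidableEq n] {γ β : ℝ} (hn : 1 < Fintype.card n)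
    (hβ : 0 < β) (hγβ : 0 ≤ γ + β) {ψ : EuclideanSpace ℂ (n × n)} {u : n → ℝ}
    {a b : OrthonormalBasis n ℂ (EuclideanSpace ℂ n)} (hS : IsSchmidtDecomposition ψ u a b)
    (hψ : ‖ψ‖ = 1) {e : OrthonormalBasis n ℂ (EuclideanSpace ℂ n)}
    (he : condEntropy (spiked γ β ψ) (basisMeasurement e) ≤
      ∑ i, profile (Fintype.card n) γ β (u i ^ 2)) :
    IsEigenbasis (traceA (spiked γ β ψ)) e := by
  have : Nonempty n := Fintype.card_pos_iff.1 (by omega)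
  have hd : (1 : ℝ) < Fintype.card n := by exact_mod_cast hn
  rw [condEntropy_spiked_basisMeasurement hβ.le hγβ hS hψ] at he
  have hge : ∀ k, ∑ i, ‖inner ℂ (b i) (e k)‖ ^ 2 * profile (Fintype.card n) γ β (u i ^ 2) ≤
      profile (Fintype.card n) γ β (‖contract (e k) ψ‖ ^ 2) := fun k =>
    sum_mul_profile_le_profile_contract hd.le hβ.le hγβ hS hψ (e.norm_eq_one k)
  have hsum : ∑ k, ∑ i, ‖inner ℂ (b i) (e k)‖ ^ 2 * profile (Fintype.card n) γ β (u i ^ 2) =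
      ∑ i, profile (Fintype.card n) γ β (u i ^ 2) := by
    rw [Finset.sum_comm]
    refine Finset.sum_congr rfl fun i _ => ?_
    rw [← Finset.sum_mul, e.sum_sq_norm_inner_left, b.norm_eq_one, one_pow, one_mul]
  rw [← hsum] at he
  -- The bound holds for each k and the totals agree, so each single bound is an equality.
  have heq := (Finset.sum_eq_sum_iff_of_le fun k _ => hge k).1
    (le_antisymm (Finset.sum_le_sum fun k _ => hge k) he)
  intro k
  rw [traceA_spiked γ β hS]
  refine ⟨_, (sum_smul_ketBra_mulVec_eq_smul_iff b _ (e k)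
    ((γ * ‖contract (e k) ψ‖ ^ 2 + Fintype.card n * β : ℝ) : ℂ)).2 fun i hi => ?_⟩
  have h := (heq k (Finset.mem_univ k)).ge
  rw [hS.norm_contract_sq] at h ⊢
  rw [eq_of_profile_le_sum hd hβ hγβ (fun i => sq_nonneg _)
    (by rw [b.sum_sq_norm_inner_right, e.norm_eq_one, one_pow]) (fun i => sq_nonneg _)
    (hS.sq_le_one hψ) h (i := i) (by simpa using hi)]

/-! ### Relative entropy of quantumness -/

theorem posSemidef_sum_smul_ketBra (e : ι → EuclideanSpace ℂ n) {q : ι → ℝ}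
    (hq : ∀ i, 0 ≤ q i) : (∑ i, (q i : ℂ) • ketBra (e i)).PosSemidef :=
  Matrix.posSemidef_sum _ fun i _ =>
    (ketBra_posSemidef (e i)).smul (Complex.zero_le_real.2 (hq i))

theorem posSemidef_spiked [DecidableEq n] [Nonempty n] {γ β : ℝ} (hβ : 0 ≤ β)
    (hγβ : 0 ≤ γ + β) {ψ : EuclideanSpace ℂ n} (hψ : ‖ψ‖ = 1) : (spiked γ β ψ).PosSemidef := by
  obtain ⟨e, i, h⟩ := smul_ketBra_add_smul_one ψ γ β
  rw [spiked, h]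
  refine posSemidef_sum_smul_ketBra _ fun j => ?_
  split_ifs
  · rwa [hψ, one_pow, mul_one]
  · exact hβ

theorem mulVec_eq_zero_of_expVal_eq_zero {M : Matrix n n ℂ} (hM : M.PosSemidef)
    {v : EuclideanSpace ℂ n} (h : expVal M v = 0) : M *ᵥ v.ofLp = 0 := by
  classical
  exact (hM.dotProduct_mulVec_zero_iff _).1 h

theorem negMulLogb_jensen {γ β : ℝ} (hβ : 0 ≤ β) (hγβ : 0 ≤ γ + β)
    {W x : ι → ℝ} (hW : ∀ i, 0 ≤ W i) (hW1 : ∑ i, W i = 1) (hx0 : ∀ i, 0 ≤ x i)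
    (hx1 : ∀ i, x i ≤ 1) :
    ∑ i, W i * negMulLogb (γ * x i + β) ≤ negMulLogb (γ * ∑ i, W i * x i + β) := by
  have h := concaveOn_negMulLogb.le_map_sum (t := Finset.univ) (w := W)
    (p := fun i => γ * x i + β) (fun i _ => hW i) hW1
    (fun i _ => affine_nonneg hβ hγβ (hx0 i) (hx1 i))
  rw [sum_weight_affine hW1] at h
  simpa using h

theorem sum_negMulLogb_le_sum_contract {γ β : ℝ} (hβ : 0 ≤ β) (hγβ : 0 ≤ γ + β)
    {ψ : EuclideanSpace ℂ (n × n)} {u : n → ℝ}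
    {a b : OrthonormalBasis n ℂ (EuclideanSpace ℂ n)} (hS : IsSchmidtDecomposition ψ u a b)
    (hψ : ‖ψ‖ = 1) (e : OrthonormalBasis n ℂ (EuclideanSpace ℂ n)) :
    ∑ i, negMulLogb (γ * u i ^ 2 + β) ≤
      ∑ k, negMulLogb (γ * ‖contract (e k) ψ‖ ^ 2 + β) := by
  calc ∑ i, negMulLogb (γ * u i ^ 2 + β)
      = ∑ k, ∑ i, ‖inner ℂ (b i) (e k)‖ ^ 2 * negMulLogb (γ * u i ^ 2 + β) := by
        rw [Finset.sum_comm]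
        refine Finset.sum_congr rfl fun i _ => ?_
        rw [← Finset.sum_mul, e.sum_sq_norm_inner_left, b.norm_eq_one, one_pow, one_mul]
    _ ≤ _ := by
        refine Finset.sum_le_sum fun k _ => ?_
        rw [hS.norm_contract_sq]
        exact negMulLogb_jensen hβ hγβ (fun i => sq_nonneg _)
          (by rw [b.sum_sq_norm_inner_right, e.norm_eq_one, one_pow]) (fun i => sq_nonneg _)
          (hS.sq_le_one hψ)

theorem fullyClassical_subset_quantumClassical [DecidableEq m] [DecidableEq n] :
    fullyClassical m n ⊆ quantumClassical m n := by
  rintro σ ⟨p, τ, η, hp, hp1, hτ, -, hσ⟩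
  exact ⟨p, τ, η, hp, hp1, hτ, hσ⟩

/-- Each τ_k is diagonalized separately, giving an Alice basis that depends on Bob's index k. -/
theorem exists_eigenbasis_of_mem_quantumClassical [DecidableEq m] [DecidableEq n]
    {σ : Matrix (m × n) (m × n) ℂ} (hσ : σ ∈ quantumClassical m n) :
    ∃ (w : n → OrthonormalBasis m ℂ (EuclideanSpace ℂ m))
      (η : OrthonormalBasis n ℂ (EuclideanSpace ℂ n))
      (e : OrthonormalBasis (m × n) ℂ (EuclideanSpace ℂ (m × n))) (q : m × n → ℝ),
      (∀ p, e p = tensorVec (w p.2 p.1) (η p.2)) ∧ (∀ p, 0 ≤ q p) ∧ ∑ p, q p = 1 ∧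
      σ = ∑ p, (q p : ℂ) • ketBra (e p) := by
  obtain ⟨p, τ, η, hp, hp1, hτ, rfl⟩ := hσ
  have hH : ∀ k, (τ k).IsHermitian := fun k => (hτ k).1.isHermitian
  obtain ⟨e, he⟩ := exists_orthonormalBasis_tensorVec (fun k => (hH k).eigenvectorBasis) η
  refine ⟨fun k => (hH k).eigenvectorBasis, η, e, fun s => p s.2 * (hH s.2).eigenvalues s.1, he,
    fun s => mul_nonneg (hp _) ((hτ s.2).1.eigenvalues_nonneg _), ?_, ?_⟩
  · rw [Fintype.sum_prod_type_right, ← hp1]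
    refine Finset.sum_congr rfl fun k _ => ?_
    have h : ∑ j, (hH k).eigenvalues j = 1 := by
      have := (hτ k).2
      rw [(hH k).trace_eq_sum_eigenvalues] at this
      rw [← Complex.ofReal_inj, Complex.ofReal_sum]
      simpa using this
    simp only
    rw [← Finset.mul_sum, h, mul_one]
  · rw [Fintype.sum_prod_type_right]
    refine Finset.sum_congr rfl fun k _ => ?_
    simp only [he, ketBra_tensorVec, Complex.ofReal_mul, mul_smul, ← Finset.smul_sum]
    congr 1
    conv_lhs => rw [(hH k).eq_sum_eigenvalues_smul_ketBra]
    ext ⟨x, y⟩ ⟨x', y'⟩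
    simp [Matrix.sum_apply, Finset.sum_mul, mul_assoc]

/-- The entropy of `γ|ψ⟩⟨ψ| + β` dephased in the Schmidt bases, minus its own entropy. -/
def spikedDiscord [DecidableEq n] (γ β : ℝ) (ψ : EuclideanSpace ℂ (n × n)) (u : n → ℝ) : ℝ :=
  ∑ i, (negMulLogb (γ * u i ^ 2 + β) + ((Fintype.card n : ℝ) - 1) * negMulLogb β) -
    entropy (spiked γ β ψ)

/-- After Gibbs' inequality, the diagonal of ρ is treated blockwise: for fixed k, Alice's index is
collapsed by `sum_negMulLogb_ge`, and the blocks are compared with the Schmidt basis by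
`sum_negMulLogb_le_sum_contract`. -/
theorem spikedDiscord_le_relEntropy [DecidableEq n] {γ β : ℝ} (hβ : 0 ≤ β) (hγβ : 0 ≤ γ + β)
    (htr : γ + (Fintype.card n : ℝ) ^ 2 * β = 1)
    {ψ : EuclideanSpace ℂ (n × n)} {u : n → ℝ}
    {a b : OrthonormalBasis n ℂ (EuclideanSpace ℂ n)} (hS : IsSchmidtDecomposition ψ u a b)
    (hψ : ‖ψ‖ = 1) {σ : Matrix (n × n) (n × n) ℂ} (hσ : σ ∈ quantumClassical n n) :
    (spikedDiscord γ β ψ u : EReal) ≤ relEntropy (spiked γ β ψ) σ := by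
  obtain ⟨w, η, e, q, he, hq, hq1, rfl⟩ := exists_eigenbasis_of_mem_quantumClassical hσ
  rw [relEntropy]
  split_ifs with hker
  · set y : n × n → ℝ := fun p => ‖inner ℂ (e p) ψ‖ ^ 2 with hy
    have hexp : ∀ p, expVal (spiked γ β ψ) (e p) = (γ * y p + β : ℝ) := fun p =>
      expVal_spiked γ β ψ (e.norm_eq_one p)
    have hy1 : ∑ p, y p = 1 := by
      rw [hy, e.sum_sq_norm_inner_right, hψ, one_pow]
    have hb0 : ∀ p, 0 ≤ γ * y p + β := fun p => affine_nonneg hβ hγβ (sq_nonneg _)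
      (hy1 ▸ Finset.single_le_sum (f := y) (fun p _ => sq_nonneg _) (Finset.mem_univ p))
    -- The kernel condition on σ becomes the support condition in Gibbs' inequality.
    have hzero : ∀ p, q p = 0 → γ * y p + β = 0 := by
      intro p hp
      have h1 := hker (e p).ofLp (by rw [sum_smul_ketBra_mulVec, hp]; simp)
      have h2 := hexp p
      rw [expVal, h1, dotProduct_zero] at h2
      exact_mod_cast h2.symm
    have hg := homEntropy_le hb0 hq hq1 hzero
    -- The trace of ρ is 1, so the normalizing term of `homEntropy` drops out.
    have hsum : ∑ p, (γ * y p + β) = 1 := by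
      rw [Finset.sum_add_distrib, ← Finset.mul_sum, hy1, Finset.sum_const, Finset.card_univ,
        Fintype.card_prod, nsmul_eq_mul]
      push_cast
      linarith
    rw [homEntropy, hsum, negMulLogb_one, sub_zero, Fintype.sum_prod_type_right] at hg
    have hyk : ∀ k, ∑ j, y (j, k) = ‖contract (η k) ψ‖ ^ 2 := by
      intro k
      rw [← (w k).sum_sq_norm_inner_right]
      refine Finset.sum_congr rfl fun j _ => ?_
      simp only [hy, he, inner_tensorVec_left]
    have hk : ∀ k, negMulLogb (γ * ‖contract (η k) ψ‖ ^ 2 + β) +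
        ((Fintype.card n : ℝ) - 1) * negMulLogb β ≤ ∑ j, negMulLogb (γ * y (j, k) + β) := by
      intro k
      rw [← hyk]
      refine sum_negMulLogb_ge hβ hγβ (fun j => sq_nonneg _) ?_
      rw [hyk]
      exact hS.norm_contract_sq_le hψ (η.norm_eq_one k)
    have h1 := Finset.sum_le_sum fun k (_ : k ∈ Finset.univ) => hk k
    have h2 := sum_negMulLogb_le_sum_contract hβ hγβ hS hψ η
    rw [EReal.coe_le_coe_iff, spikedDiscord, trace_mul_matLog]
    simp only [hexp, Complex.ofReal_re]
    rw [Finset.sum_add_distrib] at h1 ⊢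
    linarith
  · exact le_top

/-! ### Dephasing in the Schmidt bases -/

theorem ketBra_mul_mul_ketBra (M : Matrix n n ℂ) (v : EuclideanSpace ℂ n) :
    ketBra v * M * ketBra v = expVal M v • ketBra v := by
  rw [mul_assoc]
  conv_lhs => rw [ketBra]
  rw [Matrix.mul_vecMulVec, Matrix.vecMulVec_mul_vecMulVec, Matrix.vecMulVec_smul, ketBra]
  rfl

/-- The eigenvalues of `γ|ψ⟩⟨ψ| + β` dephased in the Schmidt bases. -/
def dephasedEigenvalue [DecidableEq n] (γ β : ℝ) (u : n → ℝ) (p : n × n) : ℝ :=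
  γ * (if p.1 = p.2 then u p.1 ^ 2 else 0) + β

theorem dephasedEigenvalue_nonneg [DecidableEq n] {γ β : ℝ} (hβ : 0 ≤ β) (hγβ : 0 ≤ γ + β)
    {u : n → ℝ} (hu : ∀ i, u i ^ 2 ≤ 1) (p : n × n) : 0 ≤ dephasedEigenvalue γ β u p := by
  rw [dephasedEigenvalue]
  split_ifs
  · exact affine_nonneg hβ hγβ (sq_nonneg _) (hu _)
  · simpa using hβ

theorem sum_dephasedEigenvalue_left [DecidableEq n] (γ β : ℝ) (u : n → ℝ) (j : n) :
    ∑ i, dephasedEigenvalue γ β u (i, j) = γ * u j ^ 2 + Fintype.card n * β := by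
  simp [dephasedEigenvalue, Finset.sum_add_distrib]

theorem sum_dephasedEigenvalue_right [DecidableEq n] (γ β : ℝ) (u : n → ℝ) (i : n) :
    ∑ j, dephasedEigenvalue γ β u (i, j) = γ * u i ^ 2 + Fintype.card n * β := by
  simp [dephasedEigenvalue, Finset.sum_add_distrib]

theorem expVal_spiked_tensorVec [DecidableEq n] (γ β : ℝ) {ψ : EuclideanSpace ℂ (n × n)}
    {u : n → ℝ} {a b : OrthonormalBasis n ℂ (EuclideanSpace ℂ n)}
    (hS : IsSchmidtDecomposition ψ u a b) (i j : n) :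
    expVal (spiked γ β ψ) (tensorVec (a i) (b j)) = dephasedEigenvalue γ β u (i, j) := by
  obtain ⟨e, he⟩ := exists_orthonormalBasis_tensorVec (fun _ => a) b
  rw [expVal_spiked γ β ψ (he (i, j) ▸ e.norm_eq_one (i, j)), hS.inner_tensorVec,
    dephasedEigenvalue]
  congr 3
  split_ifs <;> simp

theorem dephase_spiked [DecidableEq n] (γ β : ℝ) {ψ : EuclideanSpace ℂ (n × n)} {u : n → ℝ}
    {a b : OrthonormalBasis n ℂ (EuclideanSpace ℂ n)} (hS : IsSchmidtDecomposition ψ u a b) :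
    dephase a b (spiked γ β ψ) =
      ∑ i, ∑ j, (dephasedEigenvalue γ β u (i, j) : ℂ) • (ketBra (a i) ⊗ₖ ketBra (b j)) := by
  rw [dephase]
  refine Finset.sum_congr rfl fun i _ => Finset.sum_congr rfl fun j _ => ?_
  rw [← ketBra_tensorVec, ketBra_mul_mul_ketBra, expVal_spiked_tensorVec γ β hS]

theorem exists_eigenbasis_dephase_spiked [DecidableEq n] (γ β : ℝ)
    {ψ : EuclideanSpace ℂ (n × n)} {u : n → ℝ}
    {a b : OrthonormalBasis n ℂ (EuclideanSpace ℂ n)} (hS : IsSchmidtDecomposition ψ u a b) :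
    ∃ e : OrthonormalBasis (n × n) ℂ (EuclideanSpace ℂ (n × n)),
      dephase a b (spiked γ β ψ) = ∑ p, (dephasedEigenvalue γ β u p : ℂ) • ketBra (e p) ∧
      ∀ p, expVal (spiked γ β ψ) (e p) = dephasedEigenvalue γ β u p := by
  obtain ⟨e, he⟩ := exists_orthonormalBasis_tensorVec (fun _ => a) b
  refine ⟨e, ?_, fun p => ?_⟩
  · rw [dephase_spiked γ β hS, Fintype.sum_prod_type]
    simp only [he, ketBra_tensorVec]
  · rw [he, expVal_spiked_tensorVec γ β hS]

theorem entropy_dephase_spiked [DecidableEq n] (γ β : ℝ) {ψ : EuclideanSpace ℂ (n × n)}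
    {u : n → ℝ} {a b : OrthonormalBasis n ℂ (EuclideanSpace ℂ n)}
    (hS : IsSchmidtDecomposition ψ u a b) :
    entropy (dephase a b (spiked γ β ψ)) =
      ∑ i, (negMulLogb (γ * u i ^ 2 + β) + ((Fintype.card n : ℝ) - 1) * negMulLogb β) := by
  obtain ⟨e, he, -⟩ := exists_eigenbasis_dephase_spiked γ β hS
  rw [he, entropy_sum_smul_ketBra, Fintype.sum_prod_type]
  refine Finset.sum_congr rfl fun i _ => ?_
  rw [← sum_ite_eq_add i]
  refine Finset.sum_congr rfl fun j _ => ?_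
  by_cases h : j = i
  · simp [dephasedEigenvalue, h]
  · simp [dephasedEigenvalue, h, Ne.symm h]

/-- In the eigenbasis of Δ(ρ) both ρ and Δ(ρ) have the same diagonal, so tr ρ log Δ(ρ) = -S(Δ(ρ)).
The kernel inclusion holds because a positive semidefinite matrix annihilates every vector of zero
expectation. -/
theorem relEntropy_dephase_spiked [DecidableEq n] {γ β : ℝ} (hβ : 0 ≤ β) (hγβ : 0 ≤ γ + β)
    {ψ : EuclideanSpace ℂ (n × n)} {u : n → ℝ}
    {a b : OrthonormalBasis n ℂ (EuclideanSpace ℂ n)} (hS : IsSchmidtDecomposition ψ u a b)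
    (hψ : ‖ψ‖ = 1) :
    relEntropy (spiked γ β ψ) (dephase a b (spiked γ β ψ)) = (spikedDiscord γ β ψ u : EReal) := by
  have hne : Nonempty (n × n) := by
    by_contra h
    rw [not_nonempty_iff] at h
    simp [Subsingleton.elim ψ 0] at hψ
  have hent := entropy_dephase_spiked γ β hS
  obtain ⟨e, he, hexp⟩ := exists_eigenbasis_dephase_spiked γ β hS
  rw [he] at hent
  rw [he, relEntropy, if_pos]
  · rw [EReal.coe_eq_coe_iff, spikedDiscord, ← hent, trace_mul_matLog, entropy_sum_smul_ketBra]
    simp only [hexp, Complex.ofReal_re, negMulLogb, Finset.sum_neg_distrib]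
    ring
  · intro v hv
    have h0 := (sum_smul_ketBra_mulVec_eq_smul_iff e
      (fun p => (dephasedEigenvalue γ β u p : ℂ)) (WithLp.toLp 2 v) 0).1 (by simpa using hv)
    have hv' : v = (∑ p, inner ℂ (e p) (WithLp.toLp 2 v) • e p :
        EuclideanSpace ℂ (n × n)).ofLp := by
      rw [e.sum_repr']
    rw [hv', WithLp.ofLp_sum, Matrix.mulVec_sum]
    refine Finset.sum_eq_zero fun p _ => ?_
    rw [WithLp.ofLp_smul, Matrix.mulVec_smul]
    by_cases hp : inner ℂ (e p) (WithLp.toLp 2 v) = 0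
    · rw [hp, zero_smul]
    · rw [mulVec_eq_zero_of_expVal_eq_zero (posSemidef_spiked hβ hγβ hψ)
        ((hexp p).trans (h0 p hp)), smul_zero]

theorem commute_sum_smul_ketBra [DecidableEq n] (a : OrthonormalBasis ι ℂ (EuclideanSpace ℂ n))
    (s t : ι → ℂ) : Commute (∑ i, s i • ketBra (a i)) (∑ i, t i • ketBra (a i)) :=
  eq_of_forall_mulVec_eq a fun i => by
    simp only [← Matrix.mulVec_mulVec, sum_smul_ketBra_mulVec, Matrix.mulVec_smul, smul_smul]
    rw [mul_comm]

theorem dephase_spiked_mem_fullyClassical [DecidableEq n] {γ β : ℝ} (hβ : 0 ≤ β)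
    (hγβ : 0 ≤ γ + β) (htr : γ + (Fintype.card n : ℝ) ^ 2 * β = 1)
    {ψ : EuclideanSpace ℂ (n × n)} {u : n → ℝ}
    {a b : OrthonormalBasis n ℂ (EuclideanSpace ℂ n)} (hS : IsSchmidtDecomposition ψ u a b)
    (hψ : ‖ψ‖ = 1) : dephase a b (spiked γ β ψ) ∈ fullyClassical n n := by
  set q := dephasedEigenvalue γ β u with hq
  have hq0 : ∀ s, 0 ≤ q s := dephasedEigenvalue_nonneg hβ hγβ (hS.sq_le_one hψ)
  set p : n → ℝ := fun j => ∑ i, q (i, j) with hp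
  have hp0 : ∀ j, 0 ≤ p j := fun j => Finset.sum_nonneg fun i _ => hq0 _
  -- If p j = 0 the block vanishes and any density matrix may stand there; the choice made is
  -- |a_j⟩⟨a_j|.
  set t : n → n → ℝ := fun j i =>
    if p j = 0 then (if i = j then 1 else 0) else q (i, j) / p j with ht
  have ht0 : ∀ j i, 0 ≤ t j i := by
    intro j i
    simp only [ht]
    split_ifs
    · exact zero_le_one
    · exact le_rfl
    · exact div_nonneg (hq0 _) (hp0 _)
  have hpt : ∀ j i, p j * t j i = q (i, j) := by
    intro j i
    simp only [ht]
    by_cases h : p j = 0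
    · rw [h, zero_mul]
      exact ((Finset.sum_eq_zero_iff_of_nonneg fun i _ => hq0 (i, j)).1 h i
        (Finset.mem_univ i)).symm
    · rw [if_neg h, mul_div_cancel₀ _ h]
  refine ⟨p, fun j => ∑ i, (t j i : ℂ) • ketBra (a i), b, hp0, ?_, fun j =>
    ⟨posSemidef_sum_smul_ketBra _ (ht0 j), ?_⟩, fun i j => commute_sum_smul_ketBra a _ _, ?_⟩
  · simp only [hp, hq, sum_dephasedEigenvalue_left]
    rw [Finset.sum_add_distrib, ← Finset.mul_sum, hS.sum_sq, hψ, Finset.sum_const,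
      Finset.card_univ, nsmul_eq_mul]
    linarith
  · simp only [Matrix.trace_sum, Matrix.trace_smul, trace_ketBra, a.norm_eq_one]
    have : ∑ i, t j i = 1 := by
      simp only [ht]
      by_cases h : p j = 0
      · simp [h]
      · simp only [if_neg h]
        rw [← Finset.sum_div, div_self h]
    simpa using congrArg (fun r : ℝ => (r : ℂ)) this
  · rw [dephase_spiked γ β hS, Finset.sum_comm]
    refine Finset.sum_congr rfl fun j _ => ?_
    ext ⟨x, y⟩ ⟨x', y'⟩
    simp only [Matrix.sum_apply, Matrix.smul_apply, Matrix.kroneckerMap_apply, Finset.sum_mul,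
      smul_eq_mul, Finset.mul_sum]
    refine Finset.sum_congr rfl fun i _ => ?_
    rw [← hq, ← hpt]
    push_cast
    ring

theorem traceB_dephase_spiked [DecidableEq n] (γ β : ℝ) {ψ : EuclideanSpace ℂ (n × n)}
    {u : n → ℝ} {a b : OrthonormalBasis n ℂ (EuclideanSpace ℂ n)}
    (hS : IsSchmidtDecomposition ψ u a b) :
    traceB (dephase a b (spiked γ β ψ)) = traceB (spiked γ β ψ) := by
  rw [traceB_spiked γ β hS, dephase_spiked γ β hS, traceB_sum]
  refine Finset.sum_congr rfl fun i _ => ?_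
  simp only [traceB_sum, traceB_smul, traceB_kronecker, trace_ketBra, b.norm_eq_one,
    ← sum_dephasedEigenvalue_right γ β u i]
  simp [Finset.sum_smul]

theorem traceA_dephase_spiked [DecidableEq n] (γ β : ℝ) {ψ : EuclideanSpace ℂ (n × n)}
    {u : n → ℝ} {a b : OrthonormalBasis n ℂ (EuclideanSpace ℂ n)}
    (hS : IsSchmidtDecomposition ψ u a b) :
    traceA (dephase a b (spiked γ β ψ)) = traceA (spiked γ β ψ) := by
  rw [traceA_spiked γ β hS, dephase_spiked γ β hS, Finset.sum_comm, traceA_sum]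
  refine Finset.sum_congr rfl fun j _ => ?_
  simp only [traceA_sum, traceA_smul, traceA_kronecker, trace_ketBra, a.norm_eq_one,
    ← sum_dephasedEigenvalue_left γ β u j]
  simp [Finset.sum_smul]

/-! ### Discord -/

/-- The supremum is attained at the Schmidt basis. S(ρ^A) cancels outright, and S(ρ^B) cancels
against the terms -`negMulLogb` (γ u_i² + dβ) of the profiles. -/
theorem discord_spiked {d : ℕ} [NeZero d] {γ β : ℝ} (hβ : 0 ≤ β) (hγβ : 0 ≤ γ + β)
    {ψ : EuclideanSpace ℂ (Fin d × Fin d)} {u : Fin d → ℝ}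
    {a b : OrthonormalBasis (Fin d) ℂ (EuclideanSpace ℂ (Fin d))}
    (hS : IsSchmidtDecomposition ψ u a b) (hψ : ‖ψ‖ = 1) :
    discord (spiked γ β ψ) = spikedDiscord γ β ψ u := by
  have hc : classicalCorrelations (spiked γ β ψ) =
      entropy (traceB (spiked γ β ψ)) - ∑ i, profile (Fintype.card (Fin d)) γ β (u i ^ 2) := by
    refine IsGreatest.csSup_eq ⟨⟨d, basisMeasurement b, isPOVM_basisMeasurement b, ?_⟩, ?_⟩
    · rw [condEntropy_spiked_of_isEigenbasis hβ hγβ hS hψ (isEigenbasis_traceA_spiked γ β hS)]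
    · rintro _ ⟨k, E, hE, rfl⟩
      exact sub_le_sub_left (sum_profile_le_condEntropy hβ hγβ hS hψ hE) _
  rw [discord, hc, mutualInformation, traceA_spiked γ β hS, entropy_sum_smul_ketBra b,
    spikedDiscord]
  simp only [profile]
  rw [Finset.sum_sub_distrib]
  ring

theorem isOptimalMeasurement_spiked_iff {d : ℕ} [NeZero d] {γ β : ℝ} (hβ : 0 ≤ β)
    (hγβ : 0 ≤ γ + β) {ψ : EuclideanSpace ℂ (Fin d × Fin d)} {u : Fin d → ℝ}
    {a b : OrthonormalBasis (Fin d) ℂ (EuclideanSpace ℂ (Fin d))}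
    (hS : IsSchmidtDecomposition ψ u a b) (hψ : ‖ψ‖ = 1)
    (e : OrthonormalBasis (Fin d) ℂ (EuclideanSpace ℂ (Fin d))) :
    IsOptimalMeasurement (spiked γ β ψ) (basisMeasurement e) ↔
      condEntropy (spiked γ β ψ) (basisMeasurement e) ≤
        ∑ i, profile (Fintype.card (Fin d)) γ β (u i ^ 2) := by
  constructor
  · intro h
    refine (h.2 d (basisMeasurement b) (isPOVM_basisMeasurement b)).trans_eq ?_
    exact condEntropy_spiked_of_isEigenbasis hβ hγβ hS hψ (isEigenbasis_traceA_spiked γ β hS)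
  · intro h
    exact ⟨isPOVM_basisMeasurement e, fun k F hF =>
      h.trans (sum_profile_le_condEntropy hβ hγβ hS hψ hF)⟩

theorem pseudoPure_eq_spiked (d : ℕ) (α : ℝ) (ψ : EuclideanSpace ℂ (Fin d × Fin d)) :
    pseudoPure d α ψ =
      spiked (α - (1 - α) / ((d : ℝ) ^ 2 - 1)) ((1 - α) / ((d : ℝ) ^ 2 - 1)) ψ := by
  rw [pseudoPure, spiked, smul_sub, Complex.ofReal_sub, sub_smul]
  abel

end QuantumCorrelations

end

/-! ### Pseudo-pure states -/

theorem mainTheorem2 (d : ℕ) (hd : 2 ≤ d) (α : ℝ) (hα0 : 0 ≤ α) (hα1 : α ≤ 1)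
    (ψ : EuclideanSpace ℂ (Fin d × Fin d)) (hψ : ‖ψ‖ = 1) (u : Fin d → ℝ)
    (a b : OrthonormalBasis (Fin d) ℂ (EuclideanSpace ℂ (Fin d)))
    (hS : QuantumCorrelations.IsSchmidtDecomposition ψ u a b) :
    -- the closed formula for the discord
    (QuantumCorrelations.discord (QuantumCorrelations.pseudoPure d α ψ) =
      α * Real.logb 2 α
        + (1 - α) / ((d : ℝ) + 1) * Real.logb 2 ((1 - α) / ((d : ℝ) ^ 2 - 1))
        - ∑ i, ((1 - α) - u i ^ 2 * (1 - (d : ℝ) ^ 2 * α)) / ((d : ℝ) ^ 2 - 1)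
            * Real.logb 2 (((1 - α) - u i ^ 2 * (1 - (d : ℝ) ^ 2 * α)) / ((d : ℝ) ^ 2 - 1))) ∧
    -- Bob's Schmidt basis is a local eigenbasis, and measuring in it is optimal
    QuantumCorrelations.IsEigenbasis
      (QuantumCorrelations.traceA (QuantumCorrelations.pseudoPure d α ψ)) b ∧
    QuantumCorrelations.IsOptimalMeasurement (QuantumCorrelations.pseudoPure d α ψ)
      (QuantumCorrelations.basisMeasurement b) ∧
    -- so is every local eigenbasis, and, unless the state is pure, no other basis is optimal
    (∀ e : OrthonormalBasis (Fin d) ℂ (EuclideanSpace ℂ (Fin d)),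
      (QuantumCorrelations.IsEigenbasis
          (QuantumCorrelations.traceA (QuantumCorrelations.pseudoPure d α ψ)) e →
        QuantumCorrelations.IsOptimalMeasurement (QuantumCorrelations.pseudoPure d α ψ)
          (QuantumCorrelations.basisMeasurement e)) ∧
      (α ≠ 1 →
        QuantumCorrelations.IsOptimalMeasurement (QuantumCorrelations.pseudoPure d α ψ)
          (QuantumCorrelations.basisMeasurement e) →
        QuantumCorrelations.IsEigenbasis
          (QuantumCorrelations.traceA (QuantumCorrelations.pseudoPure d α ψ)) e)) ∧
    -- the relative entropies of quantumness coincide with the discord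
    QuantumCorrelations.oneSidedREQ (QuantumCorrelations.pseudoPure d α ψ) =
      (QuantumCorrelations.discord (QuantumCorrelations.pseudoPure d α ψ) : EReal) ∧
    QuantumCorrelations.fullREQ (QuantumCorrelations.pseudoPure d α ψ) =
      (QuantumCorrelations.discord (QuantumCorrelations.pseudoPure d α ψ) : EReal) ∧
    -- both minima are attained at the state dephased in the local Schmidt bases
    QuantumCorrelations.dephase a b (QuantumCorrelations.pseudoPure d α ψ) ∈
      QuantumCorrelations.quantumClassical (Fin d) (Fin d) ∩
        QuantumCorrelations.fullyClassical (Fin d) (Fin d) ∧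
    QuantumCorrelations.relEntropy (QuantumCorrelations.pseudoPure d α ψ)
        (QuantumCorrelations.dephase a b (QuantumCorrelations.pseudoPure d α ψ)) =
      (QuantumCorrelations.discord (QuantumCorrelations.pseudoPure d α ψ) : EReal) ∧
    -- the measurement-induced disturbance in the local Schmidt bases has the same value
    QuantumCorrelations.mutualInformation (QuantumCorrelations.pseudoPure d α ψ)
        - QuantumCorrelations.mutualInformation
            (QuantumCorrelations.dephase a b (QuantumCorrelations.pseudoPure d α ψ)) =
      QuantumCorrelations.discord (QuantumCorrelations.pseudoPure d α ψ) := by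
  have hd' : (2 : ℝ) ≤ d := by exact_mod_cast hd
  have hden : 0 < (d : ℝ) ^ 2 - 1 := by nlinarith
  have : NeZero d := ⟨by omega⟩
  rw [QuantumCorrelations.pseudoPure_eq_spiked]
  set β : ℝ := (1 - α) / ((d : ℝ) ^ 2 - 1) with hβdef
  set γ : ℝ := α - β with hγdef
  have hβ : 0 ≤ β := div_nonneg (by linarith) hden.le
  have hαγ : γ + β = α := by rw [hγdef]; ring
  have hγβ : 0 ≤ γ + β := by rwa [hαγ]
  have hβd : ((d : ℝ) ^ 2 - 1) * β = 1 - α := mul_div_cancel₀ _ hden.ne'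
  have htr : γ + (Fintype.card (Fin d) : ℝ) ^ 2 * β = 1 := by
    rw [Fintype.card_fin]
    linarith
  have hdisc := QuantumCorrelations.discord_spiked hβ hγβ hS hψ
  have hrel := QuantumCorrelations.relEntropy_dephase_spiked hβ hγβ hS hψ
  have hfc := QuantumCorrelations.dephase_spiked_mem_fullyClassical hβ hγβ htr hS hψ
  have hqc := QuantumCorrelations.fullyClassical_subset_quantumClassical hfc
  have hopt := QuantumCorrelations.isOptimalMeasurement_spiked_iff hβ hγβ hS hψ
  have heig : ∀ e, QuantumCorrelations.IsEigenbasis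
      (QuantumCorrelations.traceA (QuantumCorrelations.spiked γ β ψ)) e →
      QuantumCorrelations.IsOptimalMeasurement (QuantumCorrelations.spiked γ β ψ)
        (QuantumCorrelations.basisMeasurement e) := fun e he =>
    (hopt e).2 (QuantumCorrelations.condEntropy_spiked_of_isEigenbasis hβ hγβ hS hψ he).le
  have hb := QuantumCorrelations.isEigenbasis_traceA_spiked γ β hS
  refine ⟨?_, hb, heig b hb, fun e => ⟨heig e, fun hα he => ?_⟩, ?_, ?_, ⟨hqc, hfc⟩,
    by rw [hrel, hdisc], ?_⟩
  · have hterm : ∀ i, ((1 - α) - u i ^ 2 * (1 - (d : ℝ) ^ 2 * α)) / ((d : ℝ) ^ 2 - 1) =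
        γ * u i ^ 2 + β := by
      intro i
      rw [hγdef, hβdef]
      field_simp
      ring
    -- The coefficient of β log β is (d² - 1) from S(ρ) minus d(d - 1) from the dephased state,
    -- which is d - 1.
    have hfac : (1 - α) / ((d : ℝ) + 1) = ((d : ℝ) - 1) * β := by
      rw [← hβd]
      field_simp
      ring
    rw [hdisc, QuantumCorrelations.spikedDiscord, QuantumCorrelations.entropy_spiked γ β hψ, hαγ]
    simp only [hterm, hfac, QuantumCorrelations.negMulLogb, Finset.sum_add_distrib,
      Finset.sum_const, Finset.card_univ, Fintype.card_prod, Fintype.card_fin, nsmul_eq_mul,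
      Finset.sum_neg_distrib]
    push_cast
    ring
  · have hβ' : 0 < β := div_pos (sub_pos.2 (lt_of_le_of_ne hα1 hα)) hden
    exact QuantumCorrelations.isEigenbasis_of_condEntropy_le (by rw [Fintype.card_fin]; omega) hβ'
      hγβ hS hψ ((hopt e).1 he)
  · rw [hdisc]
    exact IsLeast.csInf_eq ⟨⟨_, hqc, hrel⟩, by
      rintro _ ⟨σ, hσ, rfl⟩
      exact QuantumCorrelations.spikedDiscord_le_relEntropy hβ hγβ htr hS hψ hσ⟩
  · rw [hdisc]
    exact IsLeast.csInf_eq ⟨⟨_, hfc, hrel⟩, by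
      rintro _ ⟨σ, hσ, rfl⟩
      exact QuantumCorrelations.spikedDiscord_le_relEntropy hβ hγβ htr hS hψ
        (QuantumCorrelations.fullyClassical_subset_quantumClassical hσ)⟩
  · rw [hdisc, QuantumCorrelations.mutualInformation, QuantumCorrelations.mutualInformation,
      QuantumCorrelations.traceA_dephase_spiked γ β hS,
      QuantumCorrelations.traceB_dephase_spiked γ β hS,
      QuantumCorrelations.entropy_dephase_spiked γ β hS, QuantumCorrelations.spikedDiscord]
    ring
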